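/- **Markov incremental mirror descent.** Let $\|\cdot\|$ be a norm on $\mathbb R^d$ with dual norm $\|\cdot\|_*$, let $\mathcal X\subset\mathbb R^d$ be compact and convex, and let $\psi$ be convex and differentiable on $\mathcal X$ and $1$-strongly convex with respect to $\|\cdot\|$, i.e. $\psi(y)\ge\psi(x)+\langle\nabla\psi(x),y-x\rangle+\tfrac12\|x-y\|^2$ for $x,y\in\mathcal X$. Put $D(x,y)=\psi(x)-\psi(y)-\langle\nabla\psi(y),x-y\rangle$ and let $R>0$ satisfy $D(x,y)\le\tfrac12R^2$ for all $x,y\in\mathcal X$. Let $n\ge2$, let $\Pi_1,\dots,\Pi_n$ be probability distributions on a measurable space $\Xi$, let $F:\mathcal X\times\Xi\to\mathbb R$ be measurable, with $F(\cdot;\xi)$ convex for every $\xi$ and $F(x;\cdot)$ $\Pi_i$-integrable for every $x\in\mathcal X$ and every $i$, and let $\mathsf G(x;\xi)\in\partial F(x;\xi)$ be a fixed measurable selection of subgradients. Put $f_i(x)=\mathbb E_{\Pi_i}[F(x;\xi)]$ and $f(x)=\frac1n\sum_{i=1}^nf_i(x)$. Let $P\in\mathbb R^{n\times n}$ be doubly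 stochastic with second largest singular value $\sigma_2(P)<1$. A token $i(1),i(2),\dots\in\{1,\dots,n\}$, with $i(1)$ of arbitrary law, moves as a Markov chain with transition matrix $P$; at each time $t\ge1$, given the past tokens and samples and $i(t)$, a sample $\xi_t$ is drawn from $\Pi_{i(t)}$, and then $i(t+1)=j$ with probability $P_{i(t)j}$, given all tokens and samples up to time $t$. Fix $T\ge1$ and $L>0$, set $$\tau_{\rm mix}=\frac{\log(Tn)}{1-\sigma_2(P)},\qquad \alpha=\frac{R}{L\sqrt{\tau_{\rm mix}}},\qquad \alpha(t)=\frac{\alpha}{\sqrt t},$$ and, starting from an arbitrary fixed $x(1)\in\mathcal X$, let $$g(t)=\mathsf G(x(t);\xi_t),\qquad x(t+1)=\operatorname*{argmin}_{x\in\mathcal X}\Big\{\langle g(t),x\rangle+\frac1{\alpha(t)}D(x,x(t))\Big\}\quad(t\ge1).$$ Let $\widehat x(T)=\frac1T\sum_{t=1}^Tx(t)$ and let $x^\star\in\mathcal X$ be arbitrary. (a) If $\mathbb E_{\Pi_i}[\|\mathsf G(x;\xi)\|_*^2]\le L^2$ for every $i$ and every $x\in\mathcal X$, then $$\mathbb E[f(\widehat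 x(T))]-f(x^\star)\le\frac{5RL}{2}\cdot\frac{\sqrt{\tau_{\rm mix}}}{\sqrt T}+\frac{5RL}{\sqrt T}+\frac{RL}{T}\,\tau_{\rm mix}.$$ (b) Let $\delta\in(0,1)$ and $\tau_{\rm mix}\le T/2$. If for every $i$ and every $x\in\mathcal X$ we have $\|\mathsf G(x;\xi)\|_*\le L$ for $\Pi_i$-almost every $\xi$, then with probability at least $1-\delta$ $$f(\widehat x(T))-f(x^\star)\le\frac{5RL}{2}\cdot\frac{\sqrt{\tau_{\rm mix}}}{\sqrt T}+\frac{2RL}{\sqrt T}+\frac{RL}{T}\,\tau_{\rm mix}+\frac{3RL}{\sqrt T}\sqrt{\tau_{\rm mix}\log\frac{\tau_{\rm mix}}{\delta}}.$$ -/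

import Mathlib

open MeasureTheory

noncomputable section

/-- The second largest singular value of a square real matrix, acting on Euclidean space
(singular values are listed in non-increasing order, starting from index `0`). -/
def secondSingularValue {n : ℕ} (P : Matrix (Fin n) (Fin n) ℝ) : ℝ :=
  (Matrix.toEuclideanLin P).singularValues 1

/-- The mixing time bound `log (T n) / (1 - σ₂(P))`. -/
def tauMix {n : ℕ} (P : Matrix (Fin n) (Fin n) ℝ) (T : ℕ) : ℝ :=
  Real.log ((T : ℝ) * (n : ℝ)) / (1 - secondSingularValue P)

/-- The Bregman divergence `ψ(x) - ψ(y) - ⟨∇ψ(y), x - y⟩` of a prox-function `ψ` that is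
differentiable on `X`.  For convex `X` and `x, y ∈ X` the last term is the one-sided directional
derivative of `ψ` at `y` towards `x`, so it does not depend on how the derivative is
represented when `X` is lower dimensional. -/
def bregman {E : Type*} [NormedAddCommGroup E] [NormedSpace ℝ E]
    (ψ : E → ℝ) (X : Set E) (x y : E) : ℝ :=
  ψ x - ψ y - fderivWithin ℝ ψ X y (x - y)

/-- The subdifferential at `x` of a function on `X`; dual vectors are continuous linear
functionals, whose operator norm is the dual norm. -/
def subdifferentialOn {E : Type*} [NormedAddCommGroup E] [NormedSpace ℝ E]
    (X : Set E) (h : E → ℝ) (x : E) : Set (StrongDual ℝ E) :=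
  {g | ∀ y ∈ X, h x + g (y - x) ≤ h y}

/-- The conditions on the constraint set `X`, the prox-function `ψ` and the radius `R`:
`X` is compact and convex, `ψ` is convex, differentiable and `1`-strongly convex on `X` with
respect to the norm, and its Bregman divergence is at most `R ^ 2 / 2` on `X`. -/
structure IsProxSetup {E : Type*} [NormedAddCommGroup E] [NormedSpace ℝ E]
    (X : Set E) (ψ : E → ℝ) (R : ℝ) : Prop where
  isCompact : IsCompact X
  convex : Convex ℝ X
  convexOn : ConvexOn ℝ X ψ
  differentiableOn : DifferentiableOn ℝ ψ X
  stronglyConvex : ∀ x ∈ X, ∀ y ∈ X,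
    ψ x + fderivWithin ℝ ψ X x (y - x) + (1 / 2) * ‖x - y‖ ^ 2 ≤ ψ y
  bregman_le : ∀ x ∈ X, ∀ y ∈ X, bregman ψ X x y ≤ (1 / 2) * R ^ 2

/-- The conditions on the instantaneous losses `F(x; ξ)`, the local distributions `Q i` and the
fixed measurable subgradient selection `G(x; ξ)`. -/
structure IsLossFamily {E : Type*} [NormedAddCommGroup E] [NormedSpace ℝ E] [MeasurableSpace E]
    {Ξ : Type*} [MeasurableSpace Ξ] {n : ℕ}
    (X : Set E) (Q : Fin n → Measure Ξ) (F : E → Ξ → ℝ) (G : E → Ξ → StrongDual ℝ E) :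
    Prop where
  measurable_loss : Measurable (Function.uncurry F)
  measurable_subgradient : Measurable (Function.uncurry G)
  convexOn : ∀ s, ConvexOn ℝ X (fun x => F x s)
  subgradient : ∀ s, ∀ x ∈ X, G x s ∈ subdifferentialOn X (fun y => F y s) x
  integrable : ∀ i, ∀ x ∈ X, Integrable (F x) (Q i)

/-- The objective `f(x) = (1/n) ∑ i, f_i(x)` with `f_i(x) = E_{ξ ∼ Q i} F(x; ξ)`. -/
def objective {E Ξ : Type*} [MeasurableSpace Ξ] {n : ℕ}
    (Q : Fin n → Measure Ξ) (F : E → Ξ → ℝ) (x : E) : ℝ :=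
  (1 / (n : ℝ)) * ∑ i, ∫ s, F x s ∂(Q i)

/-- The σ-algebra generated by the tokens and the samples at the times `1, …, t`. -/
abbrev history {Ω Ξ : Type*} [MeasurableSpace Ξ] {n : ℕ}
    (token : ℕ → Ω → Fin n) (ξ : ℕ → Ω → Ξ) (t : ℕ) : MeasurableSpace Ω :=
  ⨆ s ∈ Set.Icc 1 t, (MeasurableSpace.comap (token s) ⊤ ⊔
    MeasurableSpace.comap (ξ s) inferInstance)

/-- At each time `t ≥ 1` the token sits at `token t` and a sample `ξ t` is drawn from the local
distribution `Q (token t)`, afresh given the past and `token t`; then the token moves from `i`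
to `j` with probability `P i j`, independently of the rest of the past.  The law of the first
token is arbitrary. -/
structure IsTokenSampling {Ω : Type*} [MeasurableSpace Ω] (μ : Measure Ω)
    {Ξ : Type*} [MeasurableSpace Ξ] {n : ℕ}
    (P : Matrix (Fin n) (Fin n) ℝ) (Q : Fin n → Measure Ξ)
    (token : ℕ → Ω → Fin n) (ξ : ℕ → Ω → Ξ) : Prop where
  measurable_token : ∀ t, Measurable (token t)
  measurable_sample : ∀ t, Measurable (ξ t)
  first : ∀ (j : Fin n) (A : Set Ξ), MeasurableSet A →
    μ {ω | token 1 ω = j ∧ ξ 1 ω ∈ A} = μ {ω | token 1 ω = j} * Q j A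
  step : ∀ t, 1 ≤ t → ∀ (j : Fin n) (A : Set Ξ), MeasurableSet A →
    μ[Set.indicator {ω | token (t + 1) ω = j ∧ ξ (t + 1) ω ∈ A} (fun _ => (1 : ℝ)) |
        history token ξ t]
      =ᵐ[μ] fun ω => P (token t ω) j * (Q j).real A

/-- The Markov incremental mirror descent iterates: `x 1` is a fixed point of `X` and, for
`t ≥ 1`, `x (t + 1)` minimizes `⟨g(t), z⟩ + D(z, x t) / α(t)` over `z ∈ X`, where
`g(t) = G(x t; ξ t)` is the subgradient at the current sample. -/
structure IsMirrorDescent {E : Type*} [NormedAddCommGroup E] [NormedSpace ℝ E]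
    {Ω Ξ : Type*} (X : Set E) (ψ : E → ℝ) (G : E → Ξ → StrongDual ℝ E) (α : ℕ → ℝ)
    (ξ : ℕ → Ω → Ξ) (x : ℕ → Ω → E) : Prop where
  first : ∃ x₁ ∈ X, ∀ ω, x 1 ω = x₁
  mem : ∀ t, 1 ≤ t → ∀ ω, x (t + 1) ω ∈ X
  argmin : ∀ t, 1 ≤ t → ∀ ω,
    IsMinOn (fun z => G (x t ω) (ξ t ω) z + (1 / α t) * bregman ψ X z (x t ω)) X (x (t + 1) ω)

/-- The running average `(1/T) ∑_{t=1}^T x(t)`. -/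
def averageIterate {E : Type*} [NormedAddCommGroup E] [NormedSpace ℝ E]
    {Ω : Type*} (x : ℕ → Ω → E) (T : ℕ) (ω : Ω) : E :=
  (1 / (T : ℝ)) • ∑ t ∈ Finset.Icc 1 T, x t ω

end

/-! The sample `ξ t` is not an unbiased draw for `f`: its law depends on the token, which is
correlated with the iterate. The remedy is a lag. With `τ = ⌊tauMix P T⌋`, `s = t + τ + 1` and `F_s
= F(·; ξ s)`, the gap `f(x(t+1)) - f(z)` is the sum of the sampling error `F_s(z) - F_s(x(t+1)) +
f(x(t+1)) - f(z)`, the drift `F_s(x(t+1)) - F_s(x(s))`, and the instantaneous regret `F_s(x(s)) -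
F_s(z)`.

Sampling error: `x(t+1)` is determined by the history up to `t`, and given that history the law of
`ξ s` is a mixture of the `Q j` with nearly uniform weights. A doubly stochastic `P` contracts
mean-zero vectors by `σ₂`, so the conditional mean of the error is at most `√n σ₂^τ R L`; the choice
of `τ` makes `T` such terms cost at most `2 R L`.

Drift: each mirror step moves by at most the step size times the dual norm of the gradient, so `τ`
steps cost about `τ α(t) L²`. Regret: the usual mirror descent bound over the times `τ + 1, …, T`.
The last `τ` iterates have no lagged sample before time `T`; each is charged the trivial gap `R L`.
Convexity passes from the sum to the averaged iterate (`sum_gap_le`, `gap_budget_le`,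
`objective_average_sub_le`).

For (a) expectations are taken term by term. For (b) the gradients are almost surely bounded, so
drift and regret are deterministic, and only the sampling errors fluctuate. Errors `τ + 1` apart are
conditionally sub-Gaussian given the earlier ones, so the sum splits into `τ + 1` interleaved
sequences, each treated by Azuma–Hoeffding and recombined by convexity of `exp`
(`measureReal_interleaved_sum_ge_le`). -/

open ProbabilityTheory

/-! ### Spectral contraction of doubly stochastic matrices. -/

theorem toEuclideanLin_one_of_mulVec {n : ℕ} {P : Matrix (Fin n) (Fin n) ℝ}
    (hP : P.mulVec 1 = 1) :
    Matrix.toEuclideanLin P (WithLp.toLp 2 (fun _ => (1 : ℝ))) = WithLp.toLp 2 (fun _ => 1) := by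
  rw [Matrix.toLpLin_toLp]
  exact congrArg _ hP

/-- A doubly stochastic matrix with `σ₂ < 1` contracts the mean-zero vectors by the factor `σ₂`. -/
theorem norm_toEuclideanLin_le_secondSingularValue {n : ℕ} (hn : 2 ≤ n)
    {P : Matrix (Fin n) (Fin n) ℝ} (hP : P ∈ doublyStochastic ℝ (Fin n))
    (hσ : secondSingularValue P < 1) (v : EuclideanSpace ℝ (Fin n)) (hv : ∑ i, v i = 0) :
    ‖Matrix.toEuclideanLin P v‖ ≤ secondSingularValue P * ‖v‖ := by
  set A := Matrix.toEuclideanLin P with hA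
  have hS := A.isSymmetric_adjoint_comp_self
  have hdim : Module.finrank ℝ (EuclideanSpace ℝ (Fin n)) = n := by simp
  let b := hS.eigenvectorBasis hdim
  let ev := hS.eigenvalues hdim
  have hσ0 : 0 ≤ secondSingularValue P := A.singularValues_nonneg 1
  have hev1 : secondSingularValue P ^ 2 = ev ⟨1, hn⟩ := A.sq_singularValues_of_lt hdim hn
  have hev : ∀ i : Fin n, i ≠ ⟨0, by omega⟩ → ev i ≤ secondSingularValue P ^ 2 := by
    intro i hi
    rw [hev1]
    apply hS.eigenvalues_antitone hdim
    rw [Fin.le_def]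
    have : (i : ℕ) ≠ 0 := fun h => hi (Fin.ext h)
    simp only
    omega
  -- Row sums give `A e = e` and column sums give `A* e = e`, so the all-ones vector is fixed by `A*
  -- A`.
  let e : EuclideanSpace ℝ (Fin n) := WithLp.toLp 2 (fun _ => (1 : ℝ))
  have hSe : (LinearMap.adjoint A ∘ₗ A) e = e := by
    rw [LinearMap.comp_apply, hA, toEuclideanLin_one_of_mulVec hP.2.1,
      ← Matrix.toEuclideanLin_conjTranspose_eq_adjoint]
    apply toEuclideanLin_one_of_mulVec
    rw [Matrix.conjTranspose_eq_transpose_of_trivial, Matrix.mulVec_transpose]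
    exact hP.2.2
  have hrepr : ∀ w i, b.repr ((LinearMap.adjoint A ∘ₗ A) w) i = ev i * b.repr w i :=
    fun w i => hS.eigenvectorBasis_apply_self_apply hdim w i
  -- Only the top eigenvalue can equal `1`, so the fixed vector `e` has no component along the other
  -- eigenvectors.
  have he : ∀ i : Fin n, i ≠ ⟨0, by omega⟩ → b.repr e i = 0 := by
    intro i hi
    have h1 := hrepr e i
    rw [hSe] at h1
    have h2 : ev i < 1 := by nlinarith [hev i hi]
    have h3 : (1 - ev i) * b.repr e i = 0 := by linarith
    rcases mul_eq_zero.1 h3 with h | h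
    · linarith
    · exact h
  have hinner : ∀ w z : EuclideanSpace ℝ (Fin n),
      inner ℝ w z = ∑ i, b.repr w i * b.repr z i := by
    intro w z
    rw [← b.repr.inner_map_map, PiLp.inner_apply]
    refine Finset.sum_congr rfl fun i _ => ?_
    rw [RCLike.inner_apply, conj_trivial, mul_comm]
  -- `e` is a nonzero multiple of the top eigenvector, hence `v ⟂ e` kills the top coordinate of
  -- `v`.
  have hv0 : b.repr v ⟨0, by omega⟩ = 0 := by
    have h1 : inner ℝ e v = 0 := by
      simp [PiLp.inner_apply, e, hv]
    rw [hinner, Finset.sum_eq_single ⟨0, by omega⟩ (fun i _ hi => by rw [he i hi, zero_mul])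
      (by simp)] at h1
    rcases mul_eq_zero.1 h1 with h | h
    · have h2 : inner ℝ e e = (n : ℝ) := by
        rw [PiLp.inner_apply]
        simp [e]
      rw [hinner, Finset.sum_eq_zero] at h2
      · have : (2 : ℝ) ≤ n := by exact_mod_cast hn
        linarith
      · intro i _
        by_cases hi : i = ⟨0, by omega⟩
        · rw [hi, h, zero_mul]
        · rw [he i hi, zero_mul]
    · exact h
  apply le_of_sq_le_sq _ (mul_nonneg hσ0 (norm_nonneg v))
  have h1 : ‖A v‖ ^ 2 = inner ℝ ((LinearMap.adjoint A ∘ₗ A) v) v := by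
    rw [LinearMap.comp_apply, LinearMap.adjoint_inner_left, real_inner_self_eq_norm_sq]
  rw [h1, mul_pow, ← real_inner_self_eq_norm_sq v, hinner, hinner, Finset.mul_sum]
  apply Finset.sum_le_sum
  intro i _
  rw [hrepr]
  by_cases hi : i = ⟨0, by omega⟩
  · rw [hi, hv0]; simp
  · nlinarith [hev i hi, mul_self_nonneg (b.repr v i)]

/-- The rows of the `k`-th power of a doubly stochastic matrix with `σ₂ < 1` average a bounded
vector up to an error `√n σ₂ ^ k`. -/
theorem abs_sum_pow_sub_le {n : ℕ} (hn : 2 ≤ n)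
    {P : Matrix (Fin n) (Fin n) ℝ} (hP : P ∈ doublyStochastic ℝ (Fin n))
    (hσ : secondSingularValue P < 1) (k : ℕ) (u : Fin n → ℝ) {B : ℝ} (hB : 0 ≤ B)
    (hu : ∀ j, |u j| ≤ B) (i : Fin n) :
    |∑ j, ((P ^ k) i j - 1 / (n : ℝ)) * u j| ≤ Real.sqrt n * secondSingularValue P ^ k * B := by
  have hn0 : (n : ℝ) ≠ 0 := by positivity
  have hσ0 : 0 ≤ secondSingularValue P := (Matrix.toEuclideanLin P).singularValues_nonneg 1
  -- Subtracting the mean `c` from `u` turns the deviation from uniform averaging into an entry of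
  -- `P ^ k` applied to a mean-zero vector, because the rows of `P ^ k` sum to one.
  set c : ℝ := (1 / (n : ℝ)) * ∑ j, u j with hc
  let v : EuclideanSpace ℝ (Fin n) := WithLp.toLp 2 (fun j => u j - c)
  have hvsum : ∑ i, v i = 0 := by
    simp only [v, hc, Finset.sum_sub_distrib, Finset.sum_const, Finset.card_univ, Fintype.card_fin,
      nsmul_eq_mul]
    field_simp
    ring
  -- Column sums keep the vector mean-zero after each application, so the contraction can be
  -- iterated.
  have key : ∀ k : ℕ, (∑ i, Matrix.toEuclideanLin (P ^ k) v i = 0) ∧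
      ‖Matrix.toEuclideanLin (P ^ k) v‖ ≤ secondSingularValue P ^ k * ‖v‖ := by
    intro k
    induction k with
    | zero => simp [hvsum]
    | succ k ih =>
      have hstep : Matrix.toEuclideanLin (P ^ (k + 1)) v
          = Matrix.toEuclideanLin P (Matrix.toEuclideanLin (P ^ k) v) := by
        rw [pow_succ', Matrix.toLpLin_apply, Matrix.toLpLin_apply, Matrix.toLpLin_apply]
        simp [Matrix.mulVec_mulVec]
      rw [hstep]
      refine ⟨?_, ?_⟩
      · rw [← ih.1]
        exact sum_mulVec_of_mem_doublyStochastic (x := (Matrix.toEuclideanLin (P ^ k) v).ofLp) hP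
      · refine (norm_toEuclideanLin_le_secondSingularValue hn hP hσ _ ih.1).trans ?_
        rw [pow_succ', mul_assoc]
        exact mul_le_mul_of_nonneg_left ih.2 hσ0
  have hvnorm : ‖v‖ ≤ Real.sqrt n * B := by
    apply le_of_sq_le_sq _ (by positivity)
    rw [EuclideanSpace.norm_sq_eq, mul_pow, Real.sq_sqrt (by positivity)]
    have h1 : ∑ j, ‖v j‖ ^ 2 = ∑ j, u j ^ 2 - n * c ^ 2 := by
      have : ∀ j, ‖v j‖ ^ 2 = u j ^ 2 - 2 * c * u j + c ^ 2 := by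
        intro j; simp only [v, Real.norm_eq_abs, sq_abs]; ring
      simp only [this, Finset.sum_add_distrib, Finset.sum_sub_distrib, ← Finset.mul_sum,
        Finset.sum_const, Finset.card_univ, Fintype.card_fin, nsmul_eq_mul]
      have : ∑ j, u j = n * c := by rw [hc]; field_simp
      rw [this]; ring
    have h2 : ∑ j, u j ^ 2 ≤ n * B ^ 2 := by
      calc ∑ j, u j ^ 2 ≤ ∑ _j : Fin n, B ^ 2 :=
            Finset.sum_le_sum fun j _ => sq_le_sq' (abs_le.1 (hu j)).1 (abs_le.1 (hu j)).2
        _ = n * B ^ 2 := by simp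
    rw [h1]
    nlinarith [sq_nonneg c, Nat.cast_nonneg (α := ℝ) n]
  have hval : ∑ j, ((P ^ k) i j - 1 / (n : ℝ)) * u j = Matrix.toEuclideanLin (P ^ k) v i := by
    have hrow := sum_row_of_mem_doublyStochastic (pow_mem hP k) i
    rw [Matrix.toLpLin_apply]
    simp only [v, Matrix.mulVec, dotProduct, sub_mul, mul_sub, Finset.sum_sub_distrib,
      ← Finset.sum_mul, ← Finset.mul_sum, hrow, hc, one_mul]
  rw [hval, ← Real.norm_eq_abs]
  calc _ ≤ ‖Matrix.toEuclideanLin (P ^ k) v‖ := PiLp.norm_apply_le _ i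
    _ ≤ secondSingularValue P ^ k * ‖v‖ := (key k).2
    _ ≤ secondSingularValue P ^ k * (Real.sqrt n * B) := by gcongr
    _ = _ := by ring

/-! ### One mirror descent step: Bregman inequalities and measurability. -/

section Prox

variable {E : Type*} [NormedAddCommGroup E] [NormedSpace ℝ E] {X : Set E} {ψ : E → ℝ} {R : ℝ}

theorem IsProxSetup.half_sq_norm_le_bregman (h : IsProxSetup X ψ R) {x y : E} (hx : x ∈ X)
    (hy : y ∈ X) : (1 / 2) * ‖x - y‖ ^ 2 ≤ bregman ψ X x y := by
  have := h.stronglyConvex y hy x hx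
  rw [norm_sub_rev] at this
  unfold bregman
  linarith

theorem IsProxSetup.bregman_nonneg (h : IsProxSetup X ψ R) {x y : E} (hx : x ∈ X)
    (hy : y ∈ X) : 0 ≤ bregman ψ X x y :=
  le_trans (by positivity) (h.half_sq_norm_le_bregman hx hy)

/-- Strong convexity and the Bregman bound sandwich `½‖x - y‖²`; this is how `R` comes to act as a
diameter. -/
theorem IsProxSetup.norm_sub_le (h : IsProxSetup X ψ R) (hR : 0 ≤ R) {x y : E} (hx : x ∈ X)
    (hy : y ∈ X) : ‖x - y‖ ≤ R := by
  apply le_of_sq_le_sq _ hR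
  have h1 := h.half_sq_norm_le_bregman hx hy
  have h2 := h.bregman_le x hx y hy
  linarith

/-- First-order optimality of a mirror descent step, in three-point form. -/
theorem IsProxSetup.three_point (h : IsProxSetup X ψ R) {g : StrongDual ℝ E} {a : ℝ} (ha : 0 < a)
    {x b z : E} (hb : b ∈ X) (hz : z ∈ X)
    (hmin : IsMinOn (fun z => g z + (1 / a) * bregman ψ X z x) X b) :
    bregman ψ X b x + bregman ψ X z b ≤ a * g (z - b) + bregman ψ X z x := by
  have hd : HasFDerivWithinAt (fun z => g z + (1 / a) * bregman ψ X z x)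
      (g + (1 / a) • (fderivWithin ℝ ψ X b - fderivWithin ℝ ψ X x)) X b := by
    unfold bregman
    apply g.hasFDerivAt.hasFDerivWithinAt.add
    apply HasFDerivWithinAt.const_mul
    apply HasFDerivWithinAt.sub
    · exact (h.differentiableOn b hb).hasFDerivWithinAt.sub_const _
    · have := ((fderivWithin ℝ ψ X x).hasFDerivAt (x := b - x)).comp b
        ((hasFDerivAt_id b).sub_const x)
      exact this.hasFDerivWithinAt
  -- The segment from `b` to `z` stays in `X`, so the directional derivative at the minimizer
  -- towards `z` is nonnegative.
  have h0 := (hmin.localize).hasFDerivWithinAt_nonneg hd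
    (sub_mem_posTangentConeAt_of_segment_subset (h.convex.segment_subset hb hz))
  simp only [add_apply, smul_apply,
    sub_apply, smul_eq_mul] at h0
  have h1 : 0 ≤ a * g (z - b) + (fderivWithin ℝ ψ X b (z - b) - fderivWithin ℝ ψ X x (z - b)) := by
    have := mul_nonneg ha.le h0
    rw [mul_add, ← mul_assoc, mul_one_div_cancel ha.ne', one_mul] at this
    exact this
  have h2 : fderivWithin ℝ ψ X x (z - b) =
      fderivWithin ℝ ψ X x (z - x) - fderivWithin ℝ ψ X x (b - x) := by
    rw [← map_sub]; congr 1; abel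
  unfold bregman
  linarith

/-- One-step regret bound of mirror descent. -/
theorem IsProxSetup.step_regret (h : IsProxSetup X ψ R) {g : StrongDual ℝ E} {a : ℝ} (ha : 0 < a)
    {x b z : E} (hx : x ∈ X) (hb : b ∈ X) (hz : z ∈ X)
    (hmin : IsMinOn (fun z => g z + (1 / a) * bregman ψ X z x) X b) :
    g (x - z) ≤ (1 / a) * (bregman ψ X z x - bregman ψ X z b) + a / 2 * ‖g‖ ^ 2 := by
  have h1 := h.three_point ha hb hz hmin
  have h2 := h.half_sq_norm_le_bregman hb hx
  have h3 : g (x - b) ≤ ‖g‖ * ‖b - x‖ := by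
    rw [norm_sub_rev]
    exact (le_abs_self _).trans (g.le_opNorm _)
  have h4 : g (x - z) = g (x - b) - g (z - b) := by rw [← map_sub]; congr 1; abel
  -- Young's inequality: `a‖g‖‖b - x‖ ≤ a²‖g‖²/2 + ‖b - x‖²/2`, and the last term is absorbed by
  -- `bregman ψ X b x`.
  have h5 : a * g (x - z) ≤ (bregman ψ X z x - bregman ψ X z b) + a ^ 2 / 2 * ‖g‖ ^ 2 := by
    have := mul_le_mul_of_nonneg_left h3 ha.le
    rw [h4]
    nlinarith [sq_nonneg (a * ‖g‖ - ‖b - x‖)]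
  have h6 : g (x - z) = (1 / a) * (a * g (x - z)) := by field_simp
  rw [h6]
  calc _ ≤ (1 / a) * ((bregman ψ X z x - bregman ψ X z b) + a ^ 2 / 2 * ‖g‖ ^ 2) := by gcongr
    _ = _ := by field_simp

/-- A mirror descent step moves by at most the step size times the dual norm of the gradient. -/
theorem IsProxSetup.norm_step_le (h : IsProxSetup X ψ R) {g : StrongDual ℝ E} {a : ℝ} (ha : 0 < a)
    {x b : E} (hx : x ∈ X) (hb : b ∈ X)
    (hmin : IsMinOn (fun z => g z + (1 / a) * bregman ψ X z x) X b) :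
    ‖b - x‖ ≤ a * ‖g‖ := by
  -- The comparison point is `x` itself: both `D(b, x)` and `D(x, b)` appear, and together they
  -- dominate the full `‖b - x‖²`.
  have h1 := h.three_point ha hb hx hmin
  have h2 := h.half_sq_norm_le_bregman hb hx
  have h3 := h.half_sq_norm_le_bregman hx hb
  have h4 : g (x - b) ≤ ‖g‖ * ‖b - x‖ := by
    rw [norm_sub_rev]
    exact (le_abs_self _).trans (g.le_opNorm _)
  have h5 : bregman ψ X x x = 0 := by simp [bregman]
  rw [norm_sub_rev] at h3
  have h6 : ‖b - x‖ * ‖b - x‖ ≤ (a * ‖g‖) * ‖b - x‖ := by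
    have := mul_le_mul_of_nonneg_left h4 ha.le
    nlinarith
  rcases (norm_nonneg (b - x)).eq_or_lt with h0 | h0
  · rw [← h0]; positivity
  · exact le_of_mul_le_mul_right h6 h0

variable [FiniteDimensional ℝ E] [MeasurableSpace E] [BorelSpace E]

/-- Measurability in the base point is the issue. Along `z - x ω` the derivative is a limit of
difference quotients at points of the segment, which lie in `X`, and `ψ` is continuous there. -/
theorem IsProxSetup.measurable_bregman (h : IsProxSetup X ψ R) {Ω : Type*} [MeasurableSpace Ω]
    {x : Ω → E} (hx : Measurable x) (hxX : ∀ ω, x ω ∈ X) {z : E} (hz : z ∈ X) :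
    Measurable fun ω => bregman ψ X z (x ω) := by
  classical
  have hc : ContinuousOn ψ X := h.differentiableOn.continuousOn
  -- Nothing is known about `ψ` off `X`, so it is replaced by zero there.
  have hψ : Measurable (X.piecewise ψ 0) := by
    apply ContinuousOn.measurable_piecewise hc continuousOn_const
    exact h.isCompact.isClosed.measurableSet
  have hψX : ∀ y : Ω → E, Measurable y → (∀ ω, y ω ∈ X) → Measurable fun ω => ψ (y ω) := by
    intro y hy hyX
    have : (fun ω => ψ (y ω)) = X.piecewise ψ 0 ∘ y :=
      funext fun ω => (Set.piecewise_eq_of_mem _ _ _ (hyX ω)).symm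
    rw [this]
    exact hψ.comp hy
  have hseg : ∀ (k : ℕ) ω, x ω + ((1 : ℝ) / (k + 1)) • (z - x ω) ∈ X := by
    intro k ω
    apply h.convex.add_smul_sub_mem (hxX ω) hz
    constructor
    · positivity
    · rw [div_le_one (by positivity)]
      have : (0 : ℝ) ≤ k := by positivity
      linarith
  have hder : Measurable fun ω => fderivWithin ℝ ψ X (x ω) (z - x ω) := by
    apply measurable_of_tendsto_metrizable
      (f := fun (k : ℕ) ω => ((k : ℝ) + 1) •
        (ψ (x ω + ((1 : ℝ) / (k + 1)) • (z - x ω)) - ψ (x ω)))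
    · intro k
      simp only [smul_eq_mul]
      have := hψX _ (by fun_prop) (hseg k)
      exact (this.sub (hψX x hx hxX)).const_mul _
    · rw [tendsto_pi_nhds]
      intro ω
      apply (h.differentiableOn (x ω) (hxX ω)).hasFDerivWithinAt.lim
      · have h1 := (tendsto_one_div_add_atTop_nhds_zero_nat (𝕜 := ℝ)).smul_const (z - x ω)
        rwa [zero_smul] at h1
      · exact Filter.Eventually.of_forall fun k => hseg k ω
      · refine tendsto_const_nhds.congr fun k => ?_
        rw [smul_smul, mul_one_div_cancel (by positivity), one_smul]
  unfold bregman
  exact (measurable_const.sub (hψX x hx hxX)).sub hder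

/-- The mirror descent step depends measurably on the current point and the gradient. -/
theorem IsProxSetup.measurable_argmin (h : IsProxSetup X ψ R) {Ω : Type*} [MeasurableSpace Ω]
    {x b : Ω → E} {g : Ω → StrongDual ℝ E} {a : ℝ} (ha : 0 < a)
    (hx : Measurable x) (hxX : ∀ ω, x ω ∈ X) (hg : Measurable g) (hbX : ∀ ω, b ω ∈ X)
    (hmin : ∀ ω, IsMinOn (fun z => g ω z + (1 / a) * bregman ψ X z (x ω)) X (b ω)) :
    Measurable b := by
  classical
  rcases isEmpty_or_nonempty Ω with hΩ | ⟨⟨ω₀⟩⟩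
  · exact measurable_of_empty b
  have : Nonempty X := ⟨⟨b ω₀, hbX ω₀⟩⟩
  obtain ⟨d, hd⟩ := TopologicalSpace.exists_dense_seq X
  let H : Ω → E → ℝ := fun ω z => g ω z + (1 / a) * bregman ψ X z (x ω)
  have hHm : ∀ z ∈ X, Measurable fun ω => H ω z := fun z hz =>
    (hg.apply_continuousLinearMap z).add ((h.measurable_bregman hx hxX hz).const_mul _)
  have hHc : ∀ ω, Continuous fun z : X => H ω z := by
    intro ω
    have hc : ContinuousOn ψ X := h.differentiableOn.continuousOn
    have hc' : Continuous fun z : X => ψ z := continuousOn_iff_continuous_domRestrict.1 hc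
    have h1 : Continuous fun z : X => fderivWithin ℝ ψ X (x ω) ((z : E) - x ω) :=
      (fderivWithin ℝ ψ X (x ω)).continuous.comp (continuous_subtype_val.sub continuous_const)
    exact ((g ω).continuous.comp continuous_subtype_val).add
      (continuous_const.mul ((hc'.sub continuous_const).sub h1))
  -- Quadratic growth around the minimizer: points with nearly minimal value are close to `b ω`, so
  -- `b` is a limit of near-minimizers taken from a countable dense set.
  have hgrow : ∀ ω, ∀ z ∈ X, ‖z - b ω‖ ^ 2 ≤ 2 * a * (H ω z - H ω (b ω)) := by
    intro ω z hz
    have h1 := h.three_point ha (hbX ω) hz (hmin ω)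
    have h2 := h.half_sq_norm_le_bregman hz (hbX ω)
    have h3 : a * (H ω z - H ω (b ω)) = a * g ω (z - b ω) + bregman ψ X z (x ω)
        - bregman ψ X (b ω) (x ω) := by
      simp only [H, map_sub]
      field_simp
      ring
    linarith
  -- Near-minimality is tested against the dense sequence only, never against `b`; the condition is
  -- a countable intersection of measurable sets and the first such index is measurable in `ω`.
  have hex : ∀ (k : ℕ) ω, ∃ i, ∀ j, H ω (d i) < H ω (d j) + 1 / ((k : ℝ) + 1) := by
    intro k ω
    obtain ⟨i, hi⟩ := hd.exists_mem_open
      ((hHc ω).isOpen_preimage (Set.Iio (H ω (b ω) + 1 / ((k : ℝ) + 1))) isOpen_Iio)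
      ⟨⟨b ω, hbX ω⟩, by
        have : (0 : ℝ) < 1 / ((k : ℝ) + 1) := by positivity
        simp only [Set.mem_preimage, Set.mem_Iio]; linarith⟩
    refine ⟨i, fun j => ?_⟩
    have h1 : H ω (b ω) ≤ H ω (d j) := hmin ω (d j).2
    have h2 : H ω (d i) < H ω (b ω) + 1 / ((k : ℝ) + 1) := hi
    linarith
  refine measurable_of_tendsto_metrizable
    (f := fun (k : ℕ) ω => ((d (Nat.find (hex k ω)) : X) : E)) (fun k => ?_) ?_
  · refine Measurable.find (f := fun i _ => ((d i : X) : E)) (fun i => measurable_const)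
      (fun i => ?_) (hex k)
    rw [Set.ofPred_forall]
    exact MeasurableSet.iInter fun j => measurableSet_lt (hHm _ (d i).2)
      ((hHm _ (d j).2).add_const _)
  · rw [tendsto_pi_nhds]
    intro ω
    rw [tendsto_iff_norm_sub_tendsto_zero]
    have hle : ∀ k : ℕ, ‖((d (Nat.find (hex k ω)) : X) : E) - b ω‖
        ≤ Real.sqrt (2 * a * (1 / ((k : ℝ) + 1))) := by
      intro k
      apply Real.le_sqrt_of_sq_le
      refine (hgrow ω _ (d _).2).trans ?_
      have h1 := Nat.find_spec (hex k ω)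
      -- The comparison with all `d j` extends to `b ω` by density and continuity.
      have h2 : H ω (d (Nat.find (hex k ω))) ≤ H ω (b ω) + 1 / ((k : ℝ) + 1) := by
        have hcl : IsClosed {z : X | H ω (d (Nat.find (hex k ω))) ≤ H ω z + 1 / ((k : ℝ) + 1)} :=
          isClosed_le continuous_const ((hHc ω).add continuous_const)
        have : (⟨b ω, hbX ω⟩ : X) ∈
            {z : X | H ω (d (Nat.find (hex k ω))) ≤ H ω z + 1 / ((k : ℝ) + 1)} := by
          apply hcl.closure_subset_iff.2 _ (hd ⟨b ω, hbX ω⟩)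
          rintro _ ⟨j, rfl⟩
          exact (h1 j).le
        exact this
      gcongr
      linarith
    refine squeeze_zero (fun k => norm_nonneg _) hle ?_
    have h1 := (tendsto_one_div_add_atTop_nhds_zero_nat (𝕜 := ℝ)).const_mul (2 * a)
    have h2 := (Real.continuous_sqrt.tendsto _).comp h1
    rwa [mul_zero, Real.sqrt_zero] at h2

end Prox

/-! ### Conditional laws depending on a finite class, and freezing. -/

section CondLaw

variable {Ω Ξ ι 𝒴 : Type*} {m mΩ : MeasurableSpace Ω} {μ : Measure Ω} [MeasurableSpace Ξ]
  [Fintype ι] [MeasurableSpace ι] [MeasurableSingletonClass ι] [MeasurableSpace 𝒴]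
  {c : Ω → ι} {K : ι → Measure Ξ} {ζ : Ω → Ξ}

/-- The conditional law of `ζ` given `m` is `K c`, where the class `c` is `m`-measurable and takes
finitely many values. -/
structure HasCondLaw (μ : Measure Ω) (m : MeasurableSpace Ω) (c : Ω → ι) (K : ι → Measure Ξ)
    (ζ : Ω → Ξ) : Prop where
  measurable_class : Measurable[m] c
  measurable : Measurable[mΩ] ζ
  measureReal_inter : ∀ B, MeasurableSet[m] B → ∀ A, MeasurableSet A →
    μ.real (B ∩ ζ ⁻¹' A) = ∑ i, μ.real (B ∩ {ω | c ω = i}) * (K i).real A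

/-- Freezing: the joint law of an `m`-measurable variable and `ζ`. -/
theorem HasCondLaw.map_eq [IsFiniteMeasure μ] [∀ i, IsProbabilityMeasure (K i)]
    (h : HasCondLaw μ m c K ζ) (hm : m ≤ mΩ) {V : Ω → 𝒴} (hV : Measurable[m] V) :
    μ.map (fun ω => ((V ω, c ω), ζ ω)) = (μ.map fun ω => (V ω, c ω)) ⊗ₘ
      ((Kernel.ofFunOfCountable K).comap (Prod.snd : 𝒴 × ι → ι) measurable_snd) := by
  have : IsMarkovKernel (Kernel.ofFunOfCountable K) := ⟨fun i => inferInstanceAs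
    (IsProbabilityMeasure (K i))⟩
  have hVc : Measurable[m] fun ω => (V ω, c ω) := hV.prodMk h.measurable_class
  have hVc' : Measurable fun ω => (V ω, c ω) := hVc.mono hm le_rfl
  have hc' : Measurable c := h.measurable_class.mono hm le_rfl
  -- Rectangles suffice; on `S ×ˢ A` the claim is the defining identity of `HasCondLaw` with `B` the
  -- preimage of `S`.
  apply Measure.ext_prod
  intro S A hS hA
  rw [Measure.map_apply (hVc'.prodMk h.measurable) (hS.prod hA),
    Measure.compProd_apply_prod hS hA, setLIntegral_map hS (Kernel.measurable_coe _ hA) hVc']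
  set B := (fun ω => (V ω, c ω)) ⁻¹' S with hB
  have hBm : MeasurableSet[m] B := hVc hS
  have h2 : ∫⁻ ω in B, K (c ω) A ∂μ = ∑ i, K i A * μ (B ∩ {ω | c ω = i}) := by
    have h1 := lintegral_map (μ := μ.restrict B) (measurable_of_countable fun i => K i A) hc'
    rw [← h1, lintegral_fintype]
    refine Finset.sum_congr rfl fun i _ => ?_
    rw [Measure.map_apply hc' (measurableSet_singleton i),
      Measure.restrict_apply (hc' (measurableSet_singleton i)), Set.inter_comm]
    rfl
  change μ (B ∩ ζ ⁻¹' A) = ∫⁻ ω in B, K (c ω) A ∂μ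
  rw [h2, ← ENNReal.toReal_eq_toReal_iff' (measure_ne_top _ _)
    (ENNReal.sum_ne_top.2 fun i _ => ENNReal.mul_ne_top (measure_ne_top _ _) (measure_ne_top _ _)),
    ENNReal.toReal_sum fun i _ => ENNReal.mul_ne_top (measure_ne_top _ _) (measure_ne_top _ _)]
  simp only [ENNReal.toReal_mul]
  refine (h.measureReal_inter B hBm A hA).trans (Finset.sum_congr rfl fun i _ => mul_comm _ _)

theorem HasCondLaw.lintegral_eq [IsFiniteMeasure μ] [∀ i, IsProbabilityMeasure (K i)]
    (h : HasCondLaw μ m c K ζ) (hm : m ≤ mΩ) {V : Ω → 𝒴} (hV : Measurable[m] V)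
    {φ : 𝒴 → Ξ → ENNReal} (hφ : Measurable (Function.uncurry φ)) :
    ∫⁻ ω, φ (V ω) (ζ ω) ∂μ = ∫⁻ ω, ∫⁻ s, φ (V ω) s ∂(K (c ω)) ∂μ := by
  have hVc' : Measurable fun ω => (V ω, c ω) := (hV.prodMk h.measurable_class).mono hm le_rfl
  have : IsMarkovKernel (Kernel.ofFunOfCountable K) := ⟨fun i => inferInstanceAs
    (IsProbabilityMeasure (K i))⟩
  have hφ' : Measurable fun q : (𝒴 × ι) × Ξ => φ q.1.1 q.2 :=
    hφ.comp (measurable_fst.fst.prodMk measurable_snd)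
  have h1 := lintegral_map (μ := μ) hφ' (hVc'.prodMk h.measurable)
  rw [h.map_eq hm hV, Measure.lintegral_compProd hφ',
    lintegral_map hφ'.lintegral_kernel_prod_right' hVc'] at h1
  exact h1.symm

theorem HasCondLaw.integral_eq [IsFiniteMeasure μ] [∀ i, IsProbabilityMeasure (K i)]
    (h : HasCondLaw μ m c K ζ) (hm : m ≤ mΩ) {V : Ω → 𝒴} (hV : Measurable[m] V)
    {φ : 𝒴 → Ξ → ℝ} (hφ : Measurable (Function.uncurry φ))
    (hint : Integrable (fun ω => φ (V ω) (ζ ω)) μ) :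
    ∫ ω, φ (V ω) (ζ ω) ∂μ = ∫ ω, ∫ s, φ (V ω) s ∂(K (c ω)) ∂μ := by
  have hVc' : Measurable fun ω => (V ω, c ω) := (hV.prodMk h.measurable_class).mono hm le_rfl
  have : IsMarkovKernel (Kernel.ofFunOfCountable K) := ⟨fun i => inferInstanceAs
    (IsProbabilityMeasure (K i))⟩
  have hφ' : Measurable fun q : (𝒴 × ι) × Ξ => φ q.1.1 q.2 :=
    hφ.comp (measurable_fst.fst.prodMk measurable_snd)
  have hVcζ := hVc'.prodMk h.measurable
  have h1 := integral_map (μ := μ) hVcζ.aemeasurable hφ'.aestronglyMeasurable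
  have h2 : Integrable (fun q : (𝒴 × ι) × Ξ => φ q.1.1 q.2)
      (μ.map fun ω => ((V ω, c ω), ζ ω)) :=
    (integrable_map_measure hφ'.aestronglyMeasurable hVcζ.aemeasurable).2 hint
  rw [h.map_eq hm hV] at h1 h2
  rw [Measure.integral_compProd h2, integral_map hVc'.aemeasurable
    (hφ'.stronglyMeasurable.integral_kernel_prod_right'.aestronglyMeasurable)] at h1
  exact h1.symm

/-- The indicator of the exceptional set has zero conditional integral for every `ω`, hence zero
integral. -/
theorem HasCondLaw.ae_of_forall_ae [IsFiniteMeasure μ] [∀ i, IsProbabilityMeasure (K i)]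
    (h : HasCondLaw μ m c K ζ) (hm : m ≤ mΩ) {V : Ω → 𝒴} (hV : Measurable[m] V)
    {p : 𝒴 → Ξ → Prop} (hp : MeasurableSet {q : 𝒴 × Ξ | p q.1 q.2})
    (hae : ∀ ω, ∀ᵐ s ∂(K (c ω)), p (V ω) s) : ∀ᵐ ω ∂μ, p (V ω) (ζ ω) := by
  classical
  have hφ : Measurable (Function.uncurry fun (y : 𝒴) (s : Ξ) =>
      ({q : 𝒴 × Ξ | p q.1 q.2}ᶜ.indicator (1 : 𝒴 × Ξ → ENNReal)) (y, s)) :=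
    measurable_one.indicator hp.compl
  have h1 := h.lintegral_eq hm hV hφ
  have h2 : ∀ ω, ∫⁻ s, ({q : 𝒴 × Ξ | p q.1 q.2}ᶜ.indicator (1 : 𝒴 × Ξ → ENNReal)) (V ω, s)
      ∂(K (c ω)) = 0 := by
    intro ω
    rw [← lintegral_zero (μ := K (c ω))]
    apply lintegral_congr_ae
    filter_upwards [hae ω] with s hs
    simp [hs]
  simp only [h2, lintegral_zero] at h1
  have hVm : Measurable V := hV.mono hm le_rfl
  have h3 : Measurable fun ω => {q : 𝒴 × Ξ | p q.1 q.2}ᶜ.indicator (1 : 𝒴 × Ξ → ENNReal)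
      (V ω, ζ ω) := hφ.comp (hVm.prodMk h.measurable)
  rw [lintegral_eq_zero_iff h3] at h1
  filter_upwards [h1] with ω hω
  by_contra hcon
  simp [hcon] at hω

end CondLaw

/-! ### Mixtures of the local distributions. -/

section Mixture

variable {Ξ : Type*} [MeasurableSpace Ξ] {n : ℕ} {p : Matrix (Fin n) (Fin n) ℝ}
  {Q : Fin n → Measure Ξ}

/-- The mixture of the measures `Q j` with the weights of the `i`-th row of `p`. -/
noncomputable def rowMixture (p : Matrix (Fin n) (Fin n) ℝ) (Q : Fin n → Measure Ξ) (i : Fin n) :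
    Measure Ξ :=
  ∑ j, ENNReal.ofReal (p i j) • Q j

theorem rowMixture_apply (i : Fin n) (A : Set Ξ) :
    rowMixture p Q i A = ∑ j, ENNReal.ofReal (p i j) * Q j A := by
  simp [rowMixture, Measure.finsetSum_apply]

theorem isProbabilityMeasure_rowMixture [∀ i, IsProbabilityMeasure (Q i)]
    (hp : ∀ i j, 0 ≤ p i j) (hp1 : ∀ i, ∑ j, p i j = 1) (i : Fin n) :
    IsProbabilityMeasure (rowMixture p Q i) := by
  constructor
  rw [rowMixture_apply]
  simp only [measure_univ, mul_one]
  rw [← ENNReal.ofReal_sum_of_nonneg fun j _ => hp i j, hp1, ENNReal.ofReal_one]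

theorem rowMixture_real [∀ i, IsProbabilityMeasure (Q i)]
    (hp : ∀ i j, 0 ≤ p i j) (i : Fin n) (A : Set Ξ) :
    (rowMixture p Q i).real A = ∑ j, p i j * (Q j).real A := by
  rw [measureReal_def, rowMixture_apply, ENNReal.toReal_sum fun j _ =>
    ENNReal.mul_ne_top ENNReal.ofReal_ne_top (measure_ne_top _ _)]
  simp only [ENNReal.toReal_mul, ENNReal.toReal_ofReal (hp i _)]
  rfl

theorem ae_rowMixture {q : Ξ → Prop} (h : ∀ j, ∀ᵐ s ∂(Q j), q s) (i : Fin n) :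
    ∀ᵐ s ∂(rowMixture p Q i), q s := by
  rw [ae_iff, rowMixture_apply]
  exact Finset.sum_eq_zero fun j _ => by rw [ae_iff.1 (h j), mul_zero]

theorem integrable_rowMixture {φ : Ξ → ℝ} (h : ∀ j, Integrable φ (Q j)) (i : Fin n) :
    Integrable φ (rowMixture p Q i) := by
  unfold rowMixture
  rw [integrable_finsetSum_measure]
  exact fun j _ => (h j).smul_measure ENNReal.ofReal_ne_top

theorem integral_rowMixture (hp : ∀ i j, 0 ≤ p i j) {φ : Ξ → ℝ} (h : ∀ j, Integrable φ (Q j))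
    (i : Fin n) : ∫ s, φ s ∂(rowMixture p Q i) = ∑ j, p i j * ∫ s, φ s ∂(Q j) := by
  unfold rowMixture
  rw [integral_finsetSum_measure fun j _ => (h j).smul_measure ENNReal.ofReal_ne_top]
  refine Finset.sum_congr rfl fun j _ => ?_
  rw [integral_smul_measure, ENNReal.toReal_ofReal (hp i j), smul_eq_mul]

end Mixture

/-! ### The filtration of tokens and samples. -/

section History

variable {Ω Ξ : Type*} [MeasurableSpace Ξ] {n : ℕ} {token : ℕ → Ω → Fin n} {ξ : ℕ → Ω → Ξ}

theorem history_mono {s t : ℕ} (hst : s ≤ t) : history token ξ s ≤ history token ξ t :=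
  biSup_mono fun _ hi => ⟨hi.1, hi.2.trans hst⟩

theorem comap_le_history {s t : ℕ} (hs : s ∈ Set.Icc 1 t) :
    MeasurableSpace.comap (token s) ⊤ ⊔ MeasurableSpace.comap (ξ s) inferInstance
      ≤ history token ξ t :=
  le_biSup (fun s => MeasurableSpace.comap (token s) ⊤ ⊔
    MeasurableSpace.comap (ξ s) inferInstance) hs

theorem measurable_token_history {s t : ℕ} (hs : s ∈ Set.Icc 1 t) :
    Measurable[history token ξ t] (token s) :=
  Measurable.of_comap_le (le_sup_left.trans (comap_le_history hs))

theorem measurable_sample_history {s t : ℕ} (hs : s ∈ Set.Icc 1 t) :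
    Measurable[history token ξ t] (ξ s) :=
  Measurable.of_comap_le (le_sup_right.trans (comap_le_history hs))

/-- Times start at `1`, so conditioning on time `0` is no conditioning; the deterministic `x 1` fits
into the same scheme as later iterates. -/
theorem history_zero : history token ξ 0 = ⊥ := by
  simp [history]

end History

/-! ### Law of a sample given an earlier history. -/

section Token

variable {Ω Ξ : Type*} [mΩ : MeasurableSpace Ω] {μ : Measure Ω} [MeasurableSpace Ξ] {n : ℕ}
  {P : Matrix (Fin n) (Fin n) ℝ} {Q : Fin n → Measure Ξ} {token : ℕ → Ω → Fin n} {ξ : ℕ → Ω → Ξ}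

theorem IsTokenSampling.history_le (h : IsTokenSampling μ P Q token ξ) (t : ℕ) :
    history token ξ t ≤ mΩ :=
  iSup₂_le fun s _ => sup_le (h.measurable_token s).comap_le (h.measurable_sample s).comap_le

variable [IsProbabilityMeasure μ]

theorem sum_measureReal_inter_eq {c : Ω → Fin n} (hc : Measurable c) {B : Set Ω} :
    ∑ i, μ.real (B ∩ {ω | c ω = i}) = μ.real B := by
  have h := sum_measureReal_preimage_singleton (μ := μ.restrict B) (f := c) Finset.univ
    (fun i _ => hc (measurableSet_singleton i))
  simp only [Finset.coe_univ, Set.preimage_univ, measureReal_restrict_apply MeasurableSet.univ,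
    Set.univ_inter] at h
  rw [← h]
  refine Finset.sum_congr rfl fun i _ => ?_
  rw [measureReal_restrict_apply (hc (measurableSet_singleton i)), Set.inter_comm]
  rfl

theorem measureReal_preimage_eq_sum {c : Ω → Fin n} {Ξ : Type*} {ζ : Ω → Ξ} (hc : Measurable c) {B : Set Ω}
    {A : Set Ξ} :
    μ.real (B ∩ ζ ⁻¹' A) = ∑ j, μ.real (B ∩ {ω | c ω = j ∧ ζ ω ∈ A}) := by
  rw [← sum_measureReal_inter_eq hc]
  refine Finset.sum_congr rfl fun j _ => ?_
  congr 1
  ext ω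
  simp only [Set.mem_inter_iff, Set.mem_preimage, Set.mem_ofPred_eq]
  tauto

/-- This is `step` integrated over a past event `B` and split according to the current token. -/
theorem IsTokenSampling.measureReal_step (h : IsTokenSampling μ P Q token ξ) {t : ℕ} (ht : 1 ≤ t)
    {B : Set Ω} (hB : MeasurableSet[history token ξ t] B) (j : Fin n) {A : Set Ξ}
    (hA : MeasurableSet A) :
    μ.real (B ∩ {ω | token (t + 1) ω = j ∧ ξ (t + 1) ω ∈ A}) =
      ∑ i, μ.real (B ∩ {ω | token t ω = i}) * (P i j * (Q j).real A) := by
  have hm := h.history_le t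
  have hS : MeasurableSet {ω | token (t + 1) ω = j ∧ ξ (t + 1) ω ∈ A} :=
    (h.measurable_token (t + 1) (measurableSet_singleton j)).inter (h.measurable_sample (t + 1) hA)
  have hBm : MeasurableSet B := hm _ hB
  have hc := h.measurable_token t
  have h1 := setIntegral_condExp hm (μ := μ)
    ((integrable_const (1 : ℝ)).indicator hS) hB
  rw [setIntegral_congr_ae hBm ((h.step t ht j A hA).mono fun ω hω _ => hω),
    integral_indicator_const _ hS, measureReal_restrict_apply hS, smul_eq_mul, mul_one,
    Set.inter_comm] at h1
  rw [← h1]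
  have h2 : ∫ ω in B, P (token t ω) j * (Q j).real A ∂μ =
      ∫ i, P i j * (Q j).real A ∂((μ.restrict B).map (token t)) := by
    rw [integral_map hc.aemeasurable (measurable_of_countable _).aestronglyMeasurable]
  rw [h2, integral_fintype Integrable.of_finite]
  refine Finset.sum_congr rfl fun i _ => ?_
  rw [map_measureReal_apply hc (measurableSet_singleton i),
    measureReal_restrict_apply (hc (measurableSet_singleton i)), Set.inter_comm, smul_eq_mul]
  rfl

variable [∀ i, IsProbabilityMeasure (Q i)]

/-- Chapman–Kolmogorov: `B` also belongs to the history at `t + 1`, so the induction hypothesis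
applies from there, and one further step with no restriction on the sample sums out `token (t + 1)`.
-/
theorem IsTokenSampling.measureReal_steps (h : IsTokenSampling μ P Q token ξ) (k : ℕ) :
    ∀ {t : ℕ}, 1 ≤ t → ∀ {B : Set Ω}, MeasurableSet[history token ξ t] B → ∀ (j : Fin n)
    {A : Set Ξ}, MeasurableSet A →
    μ.real (B ∩ {ω | token (t + k + 1) ω = j ∧ ξ (t + k + 1) ω ∈ A}) =
      ∑ i, μ.real (B ∩ {ω | token t ω = i}) * ((P ^ (k + 1)) i j * (Q j).real A) := by
  induction k with
  | zero =>
    intro t ht B hB j A hA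
    simpa using h.measureReal_step ht hB j hA
  | succ k ih =>
    intro t ht B hB j A hA
    have h1 := ih (t := t + 1) (by omega) (history_mono (by omega) _ hB) j hA
    rw [show t + 1 + k + 1 = t + (k + 1) + 1 by ring] at h1
    rw [h1]
    have h2 : ∀ l, μ.real (B ∩ {ω | token (t + 1) ω = l}) =
        ∑ i, μ.real (B ∩ {ω | token t ω = i}) * P i l := by
      intro l
      have := h.measureReal_step ht hB l MeasurableSet.univ
      simpa using this
    simp only [h2, Finset.sum_mul]
    rw [Finset.sum_comm]
    refine Finset.sum_congr rfl fun i _ => ?_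
    rw [pow_succ' P (k + 1), Matrix.mul_apply, Finset.sum_mul, Finset.mul_sum]
    exact Finset.sum_congr rfl fun l _ => by ring

theorem IsTokenSampling.measureReal_first (h : IsTokenSampling μ P Q token ξ) (k : ℕ) (j : Fin n)
    {A : Set Ξ} (hA : MeasurableSet A) :
    μ.real {ω | token (k + 1) ω = j ∧ ξ (k + 1) ω ∈ A} =
      ∑ i, μ.real {ω | token 1 ω = i} * ((P ^ k) i j * (Q j).real A) := by
  cases k with
  | zero =>
    rw [measureReal_def, h.first j A hA, ENNReal.toReal_mul, Finset.sum_eq_single j]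
    · simp [measureReal_def]
    · intro i _ hi
      simp [Matrix.one_apply_ne hi]
    · simp
  | succ k =>
    have := h.measureReal_steps k le_rfl MeasurableSet.univ j hA
    simp only [Set.univ_inter] at this
    rw [← this, show 1 + k + 1 = k + 1 + 1 by ring]

/-- The conditional law of a sample given the history `k + 1` steps before is a mixture of the
local distributions with nearly uniform weights. -/
theorem IsTokenSampling.exists_hasCondLaw (h : IsTokenSampling μ P Q token ξ) (hn : 2 ≤ n)
    (hP : P ∈ doublyStochastic ℝ (Fin n)) (hσ : secondSingularValue P < 1) (m k : ℕ) :
    ∃ (c : Ω → Fin n) (p : Matrix (Fin n) (Fin n) ℝ),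
      (∀ i j, 0 ≤ p i j) ∧ (∀ i, ∑ j, p i j = 1) ∧
      (∀ (u : Fin n → ℝ) (B : ℝ), 0 ≤ B → (∀ j, |u j| ≤ B) → ∀ i,
        |∑ j, (p i j - 1 / (n : ℝ)) * u j| ≤ Real.sqrt n * secondSingularValue P ^ k * B) ∧
      HasCondLaw μ (history token ξ m) c (rowMixture p Q) (ξ (m + k + 1)) := by
  have hσ0 : 0 ≤ secondSingularValue P := (Matrix.toEuclideanLin P).singularValues_nonneg 1
  rcases Nat.eq_zero_or_pos m with rfl | hm
  -- At `m = 0` there is no earlier token: the class is constant, and its row is the law of `token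
  -- 1` moved by `P ^ k`. Only `k` transitions have occurred, which is why the common bound has
  -- exponent `k`.
  · let w : Fin n → ℝ := fun l => μ.real {ω | token 1 ω = l}
    have hw0 : ∀ l, 0 ≤ w l := fun l => measureReal_nonneg
    have hw1 : ∑ l, w l = 1 := by
      have := sum_measureReal_inter_eq (μ := μ) (h.measurable_token 1) (B := Set.univ)
      simpa [w] using this
    have hPk : ∀ l j, 0 ≤ (P ^ k) l j := (pow_mem hP k).1
    have hp0 : ∀ i j : Fin n, 0 ≤ (Matrix.of fun (_ : Fin n) j => ∑ l, w l * (P ^ k) l j) i j :=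
      fun i j => by
        rw [Matrix.of_apply]
        exact Finset.sum_nonneg fun l _ => mul_nonneg (hw0 l) (hPk l j)
    refine ⟨fun _ => ⟨0, by omega⟩, Matrix.of fun _ j => ∑ l, w l * (P ^ k) l j, hp0, ?_, ?_,
      ⟨measurable_const, h.measurable_sample _, ?_⟩⟩
    · intro i
      simp only [Matrix.of_apply]
      rw [Finset.sum_comm]
      simp only [← Finset.mul_sum, sum_row_of_mem_doublyStochastic (pow_mem hP k), mul_one, hw1]
    · intro u B hB hu i
      have h1 : ∑ j, ((Matrix.of fun (_ : Fin n) j => ∑ l, w l * (P ^ k) l j) i j - 1 / (n : ℝ))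
          * u j = ∑ l, w l * ∑ j, ((P ^ k) l j - 1 / (n : ℝ)) * u j := by
        simp only [Matrix.of_apply, sub_mul, Finset.sum_sub_distrib, mul_sub, ← Finset.sum_mul, hw1,
          one_mul]
        congr 1
        simp only [Finset.sum_mul, Finset.mul_sum]
        rw [Finset.sum_comm]
        exact Finset.sum_congr rfl fun l _ => Finset.sum_congr rfl fun j _ => by ring
      rw [h1]
      calc _ ≤ ∑ l, |w l * ∑ j, ((P ^ k) l j - 1 / (n : ℝ)) * u j| :=
            Finset.abs_sum_le_sum_abs _ _
        _ ≤ ∑ l, w l * (Real.sqrt n * secondSingularValue P ^ k * B) := by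
            refine Finset.sum_le_sum fun l _ => ?_
            rw [abs_mul, abs_of_nonneg (hw0 l)]
            exact mul_le_mul_of_nonneg_left (abs_sum_pow_sub_le hn hP hσ k u hB hu l) (hw0 l)
        _ = _ := by rw [← Finset.sum_mul, hw1, one_mul]
    · intro B hB A hA
      rw [history_zero, MeasurableSpace.measurableSet_bot_iff] at hB
      rcases hB with rfl | rfl
      · simp
      · rw [measureReal_preimage_eq_sum (h.measurable_token (0 + k + 1))]
        symm
        rw [Finset.sum_eq_single ⟨0, by omega⟩ (fun i _ hi => by simp [Ne.symm hi]) (by simp)]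
        simp only [rowMixture_real hp0, Set.univ_inter, Set.ofPred_true, probReal_univ, one_mul,
          zero_add, h.measureReal_first k _ hA, Matrix.of_apply, Finset.sum_mul]
        exact Finset.sum_congr rfl fun j _ => Finset.sum_congr rfl fun l _ => by
          simp only [w]; ring
  -- Here `k + 1` transitions have occurred; the better factor `σ₂ ^ (k + 1)` is weakened to match
  -- the case `m = 0`.
  · have hp0 : ∀ i j, 0 ≤ (P ^ (k + 1)) i j := (pow_mem hP (k + 1)).1
    refine ⟨token m, P ^ (k + 1), hp0, sum_row_of_mem_doublyStochastic (pow_mem hP _), ?_,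
      ⟨measurable_token_history ⟨hm, le_rfl⟩, h.measurable_sample _, ?_⟩⟩
    · intro u B hB hu i
      refine (abs_sum_pow_sub_le hn hP hσ (k + 1) u hB hu i).trans ?_
      have := pow_le_pow_of_le_one hσ0 hσ.le (Nat.le_succ k)
      gcongr ?_ * ?_ * ?_
    · intro B hB A hA
      rw [measureReal_preimage_eq_sum (h.measurable_token (m + k + 1))]
      simp only [h.measureReal_steps k hm hB _ hA, rowMixture_real hp0, Finset.mul_sum]
      exact Finset.sum_comm

end Token

/-! ### Concentration for interleaved sequences. -/

section Azuma

theorem sum_range_mul_eq_sum_sum (z : ℕ → ℝ) (M q : ℕ) :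
    ∑ t ∈ Finset.range (M * q), z t =
      ∑ r ∈ Finset.range M, ∑ i ∈ Finset.range q, z (r + M * i) := by
  induction q with
  | zero => simp
  | succ q ih =>
    simp only [Finset.sum_range_succ, Finset.sum_add_distrib]
    rw [Nat.mul_succ, Finset.sum_range_add, ih]
    simp only [add_comm]

variable {Ω : Type*} {mΩ : MeasurableSpace Ω} {μ : Measure Ω} {ℋ : ℕ → MeasurableSpace Ω}
  {Z : ℕ → Ω → ℝ} {M : ℕ} {K : ℝ}

theorem measurable_interleaved_sum (hmono : Monotone ℋ) (hZ : ∀ t, Measurable[ℋ (t + M)] (Z t))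
    (r q : ℕ) :
    Measurable[ℋ (r + M * q)] fun ω => ∑ i ∈ Finset.range q, Z (r + M * i) ω := by
  refine Finset.measurable_fun_sum _ fun i hi => (hZ (r + M * i)).mono (hmono ?_) le_rfl
  rw [add_assoc, ← Nat.mul_succ]
  exact Nat.add_le_add_left (Nat.mul_le_mul_left M (Finset.mem_range.1 hi)) r

variable [IsProbabilityMeasure μ]

/-- Within one residue class modulo `M` the partial sum up to index `q` is known at time `r + M *
q`, when the next increment is conditioned; so increments peel off one at a time. -/
theorem lintegral_exp_interleaved_sum_le (hmono : Monotone ℋ)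
    (hZ : ∀ t, Measurable[ℋ (t + M)] (Z t))
    (hmgf : ∀ t, ∀ l : ℝ, 0 ≤ l → ∀ S : Ω → ℝ, Measurable[ℋ t] S →
      ∫⁻ ω, ENNReal.ofReal (Real.exp (S ω + l * Z t ω)) ∂μ ≤
        ENNReal.ofReal (Real.exp (l ^ 2 * K / 2)) * ∫⁻ ω, ENNReal.ofReal (Real.exp (S ω)) ∂μ)
    {l : ℝ} (hl : 0 ≤ l) (r q : ℕ) :
    ∫⁻ ω, ENNReal.ofReal (Real.exp (l * ∑ i ∈ Finset.range q, Z (r + M * i) ω)) ∂μ ≤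
      ENNReal.ofReal (Real.exp (q * (l ^ 2 * K / 2))) := by
  induction q with
  | zero => simp
  | succ q ih =>
    simp only [Finset.sum_range_succ, mul_add]
    refine (hmgf (r + M * q) l hl (fun ω => l * ∑ i ∈ Finset.range q, Z (r + M * i) ω)
      ((measurable_interleaved_sum hmono hZ r q).const_mul l)).trans ?_
    refine (mul_le_mul_right ih _).trans ?_
    rw [← ENNReal.ofReal_mul (Real.exp_nonneg _), ← Real.exp_add]
    apply le_of_eq
    congr 2
    push_cast
    ring

/-- Azuma–Hoeffding bound for a sum that splits into `M` interleaved sequences of increments that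
are each conditionally sub-Gaussian with non-positive mean. -/
theorem measureReal_interleaved_sum_ge_le (hmono : Monotone ℋ) (hle : ∀ t, ℋ t ≤ mΩ)
    (hM : 0 < M) (hK : 0 < K)
    (hZ : ∀ t, Measurable[ℋ (t + M)] (Z t))
    (hmgf : ∀ t, ∀ l : ℝ, 0 ≤ l → ∀ S : Ω → ℝ, Measurable[ℋ t] S →
      ∫⁻ ω, ENNReal.ofReal (Real.exp (S ω + l * Z t ω)) ∂μ ≤
        ENNReal.ofReal (Real.exp (l ^ 2 * K / 2)) * ∫⁻ ω, ENNReal.ofReal (Real.exp (S ω)) ∂μ)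
    {q : ℕ} (hq : 0 < q) {γ : ℝ} (hγ : 0 ≤ γ) :
    μ.real {ω | γ ≤ ∑ t ∈ Finset.range (M * q), Z t ω} ≤
      Real.exp (-(γ ^ 2 / (2 * M * (M * q) * K))) := by
  have hM' : (0 : ℝ) < M := by exact_mod_cast hM
  have hq' : (0 : ℝ) < q := by exact_mod_cast hq
  -- The minimizer of the Chernoff exponent `-lγ + q (lM)² K / 2`.
  set l : ℝ := γ / (M * (M * q) * K) with hl
  have hl0 : 0 ≤ l := by positivity
  have hZm : ∀ t, Measurable (Z t) := fun t => (hZ t).mono (hle _) le_rfl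
  -- The full sum is the average over residue classes of `M` times the class sums, so convexity of
  -- `exp` decouples the classes without any independence; the price is `l * M` in place of `l`.
  have hjensen : ∀ ω, Real.exp (l * ∑ t ∈ Finset.range (M * q), Z t ω) ≤
      ∑ r ∈ Finset.range M, (1 / (M : ℝ)) *
        Real.exp ((l * M) * ∑ i ∈ Finset.range q, Z (r + M * i) ω) := by
    intro ω
    have h1 := convexOn_exp.map_sum_le (t := Finset.range M) (w := fun _ => 1 / (M : ℝ))
      (p := fun r => (l * M) * ∑ i ∈ Finset.range q, Z (r + M * i) ω)
      (fun _ _ => by positivity) (by simp [hM'.ne']) (fun _ _ => Set.mem_univ _)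
    simp only [smul_eq_mul] at h1
    refine (le_of_eq ?_).trans h1
    congr 1
    rw [sum_range_mul_eq_sum_sum, Finset.mul_sum]
    refine Finset.sum_congr rfl fun r _ => ?_
    field_simp
  have hint : ∫⁻ ω, ENNReal.ofReal (Real.exp (l * ∑ t ∈ Finset.range (M * q), Z t ω)) ∂μ ≤
      ENNReal.ofReal (Real.exp (q * ((l * M) ^ 2 * K / 2))) := by
    calc _ ≤ ∫⁻ ω, ∑ r ∈ Finset.range M, ENNReal.ofReal (1 / (M : ℝ)) * ENNReal.ofReal
            (Real.exp ((l * M) * ∑ i ∈ Finset.range q, Z (r + M * i) ω)) ∂μ := by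
          refine lintegral_mono fun ω => ?_
          refine (ENNReal.ofReal_le_ofReal (hjensen ω)).trans (le_of_eq ?_)
          rw [ENNReal.ofReal_sum_of_nonneg fun r _ => by positivity]
          exact Finset.sum_congr rfl fun r _ => ENNReal.ofReal_mul (by positivity)
      _ = ∑ r ∈ Finset.range M, ENNReal.ofReal (1 / (M : ℝ)) * ∫⁻ ω, ENNReal.ofReal
            (Real.exp ((l * M) * ∑ i ∈ Finset.range q, Z (r + M * i) ω)) ∂μ := by
          rw [lintegral_finsetSum _ fun r _ => by fun_prop]
          exact Finset.sum_congr rfl fun r _ => lintegral_const_mul _ (by fun_prop)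
      _ ≤ ∑ r ∈ Finset.range M, ENNReal.ofReal (1 / (M : ℝ)) *
            ENNReal.ofReal (Real.exp (q * ((l * M) ^ 2 * K / 2))) :=
          Finset.sum_le_sum fun r _ => mul_le_mul_right
            (lintegral_exp_interleaved_sum_le hmono hZ hmgf (by positivity) r q) _
      _ = _ := by
          rw [Finset.sum_const, Finset.card_range, nsmul_eq_mul, ← mul_assoc,
            ← ENNReal.ofReal_natCast, ← ENNReal.ofReal_mul hM'.le, mul_one_div_cancel hM'.ne',
            ENNReal.ofReal_one, one_mul]
  have hcher := (mul_meas_ge_le_lintegral (μ := μ)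
    (f := fun ω => ENNReal.ofReal (Real.exp (l * ∑ t ∈ Finset.range (M * q), Z t ω)))
    (by fun_prop) (ENNReal.ofReal (Real.exp (l * γ)))).trans hint
  have hsub : {ω | γ ≤ ∑ t ∈ Finset.range (M * q), Z t ω} ⊆ {ω | ENNReal.ofReal (Real.exp (l * γ))
      ≤ ENNReal.ofReal (Real.exp (l * ∑ t ∈ Finset.range (M * q), Z t ω))} := by
    intro ω hω
    have hω' : γ ≤ ∑ t ∈ Finset.range (M * q), Z t ω := hω
    exact ENNReal.ofReal_le_ofReal (Real.exp_le_exp.2 (mul_le_mul_of_nonneg_left hω' hl0))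
  have h1 := (mul_le_mul_right (measure_mono (μ := μ) hsub) _).trans hcher
  have h2 := ENNReal.toReal_mono ENNReal.ofReal_ne_top h1
  rw [ENNReal.toReal_mul, ENNReal.toReal_ofReal (Real.exp_nonneg _),
    ENNReal.toReal_ofReal (Real.exp_nonneg _)] at h2
  have h3 : Real.exp (-(γ ^ 2 / (2 * M * (M * q) * K))) =
      (Real.exp (l * γ))⁻¹ * Real.exp (q * ((l * M) ^ 2 * K / 2)) := by
    rw [← Real.exp_neg, ← Real.exp_add]
    congr 1
    rw [hl]
    field_simp
    ring
  rw [h3, ← div_eq_inv_mul, le_div_iff₀ (Real.exp_pos _), mul_comm]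
  exact h2

end Azuma

/-! ### Pathwise regret, drift and the lagged decomposition. -/

section Regret

variable {E : Type*} [NormedAddCommGroup E] [NormedSpace ℝ E] {X : Set E} {ψ : E → ℝ} {R : ℝ}
  {y : ℕ → E} {g : ℕ → StrongDual ℝ E} {α : ℕ → ℝ}

/-- Abel summation as an induction: the slack `R² / 2 - D(z, y)` is nonnegative, so raising its
weight `1 / α` at the next step only weakens the bound. -/
theorem IsProxSetup.sum_regret_le_sub (h : IsProxSetup X ψ R) (hy : ∀ t, 1 ≤ t → y t ∈ X)
    (hα : ∀ t, 1 ≤ t → 0 < α t) (hα' : ∀ t, 1 ≤ t → α (t + 1) ≤ α t)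
    (hmin : ∀ t, 1 ≤ t →
      IsMinOn (fun z => g t z + (1 / α t) * bregman ψ X z (y t)) X (y (t + 1)))
    {z : E} (hz : z ∈ X) {a : ℕ} (ha : 1 ≤ a) (N : ℕ) :
    ∑ i ∈ Finset.range (N + 1), g (a + i) (y (a + i) - z) ≤
      (1 / α (a + N)) * (R ^ 2 / 2 - bregman ψ X z (y (a + N + 1))) +
        ∑ i ∈ Finset.range (N + 1), α (a + i) / 2 * ‖g (a + i)‖ ^ 2 := by
  have hstep : ∀ t, 1 ≤ t → g t (y t - z) ≤
      (1 / α t) * (bregman ψ X z (y t) - bregman ψ X z (y (t + 1))) + α t / 2 * ‖g t‖ ^ 2 :=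
    fun t ht => h.step_regret (hα t ht) (hy t ht) (hy (t + 1) (by omega)) hz (hmin t ht)
  have hD : ∀ t, 1 ≤ t → 0 ≤ R ^ 2 / 2 - bregman ψ X z (y t) := by
    intro t ht
    have := h.bregman_le z hz (y t) (hy t ht)
    linarith
  induction N with
  | zero =>
    simp only [zero_add, Finset.range_one, Finset.sum_singleton, add_zero]
    refine (hstep a ha).trans ?_
    have h0 := mul_nonneg (one_div_nonneg.2 (hα a ha).le) (hD a ha)
    linarith
  | succ N ih =>
    rw [Finset.sum_range_succ, Finset.sum_range_succ (fun i => α (a + i) / 2 * ‖g (a + i)‖ ^ 2)]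
    have h1 := hstep (a + (N + 1)) (by omega)
    have h2 : 1 / α (a + N) ≤ 1 / α (a + (N + 1)) :=
      one_div_le_one_div_of_le (hα _ (by omega)) (hα' (a + N) (by omega))
    have h3 := mul_le_mul_of_nonneg_right h2 (hD (a + N + 1) (by omega))
    rw [← add_assoc] at h1 h3 ⊢
    linarith

/-- Regret bound of mirror descent with non-increasing step sizes over a window of iterations. -/
theorem IsProxSetup.sum_regret_le (h : IsProxSetup X ψ R) (hy : ∀ t, 1 ≤ t → y t ∈ X)
    (hα : ∀ t, 1 ≤ t → 0 < α t) (hα' : ∀ t, 1 ≤ t → α (t + 1) ≤ α t)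
    (hmin : ∀ t, 1 ≤ t →
      IsMinOn (fun z => g t z + (1 / α t) * bregman ψ X z (y t)) X (y (t + 1)))
    {z : E} (hz : z ∈ X) {a : ℕ} (ha : 1 ≤ a) (N : ℕ) :
    ∑ i ∈ Finset.range (N + 1), g (a + i) (y (a + i) - z) ≤
      R ^ 2 / (2 * α (a + N)) + ∑ i ∈ Finset.range (N + 1), α (a + i) / 2 * ‖g (a + i)‖ ^ 2 := by
  refine (h.sum_regret_le_sub hy hα hα' hmin hz ha N).trans ?_
  have hpos := hα (a + N) (by omega)
  have h1 := mul_nonneg (one_div_nonneg.2 hpos.le)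
    (h.bregman_nonneg hz (hy (a + N + 1) (by omega)))
  have h2 : R ^ 2 / (2 * α (a + N)) = (1 / α (a + N)) * (R ^ 2 / 2) := by field_simp
  rw [h2]
  linarith

theorem IsProxSetup.norm_sub_iterate_le (h : IsProxSetup X ψ R) (hy : ∀ t, 1 ≤ t → y t ∈ X)
    (hα : ∀ t, 1 ≤ t → 0 < α t)
    (hmin : ∀ t, 1 ≤ t →
      IsMinOn (fun z => g t z + (1 / α t) * bregman ψ X z (y t)) X (y (t + 1)))
    {t : ℕ} (ht : 1 ≤ t) (k : ℕ) :
    ‖y (t + k) - y t‖ ≤ ∑ j ∈ Finset.range k, α (t + j) * ‖g (t + j)‖ := by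
  induction k with
  | zero => simp
  | succ k ih =>
    rw [Finset.sum_range_succ]
    have h1 := h.norm_step_le (hα (t + k) (by omega)) (hy (t + k) (by omega))
      (hy (t + k + 1) (by omega)) (hmin (t + k) (by omega))
    calc ‖y (t + (k + 1)) - y t‖ = ‖(y (t + k) - y t) + (y (t + k + 1) - y (t + k))‖ := by
          congr 1; rw [← add_assoc]; abel
      _ ≤ _ := (norm_add_le _ _).trans (add_le_add ih h1)

/-- Decomposition of the optimality gap of mirror descent along a path, where the losses are
evaluated with a lag `τ`: a sampling error, a drift term, the regret, and a boundary term. -/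
theorem IsProxSetup.sum_gap_le (h : IsProxSetup X ψ R) (hy : ∀ t, 1 ≤ t → y t ∈ X)
    (hα : ∀ t, 1 ≤ t → 0 < α t) (hα' : ∀ t, 1 ≤ t → α (t + 1) ≤ α t)
    {Fs : ℕ → E → ℝ} {Gs : ℕ → E → StrongDual ℝ E}
    (hsub : ∀ t, ∀ z ∈ X, Gs t z ∈ subdifferentialOn X (Fs t) z)
    (hmin : ∀ t, 1 ≤ t → IsMinOn
      (fun z => Gs t (y t) z + (1 / α t) * bregman ψ X z (y t)) X (y (t + 1)))
    {z : E} (hz : z ∈ X) {f : E → ℝ} {C : ℝ} (hf : ∀ w ∈ X, f w - f z ≤ C) (τ N : ℕ) :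
    ∑ t ∈ Finset.range (N + 1 + τ), (f (y (t + 1)) - f z) ≤
      ∑ t ∈ Finset.range (N + 1), (Fs (t + τ + 1) z - Fs (t + τ + 1) (y (t + 1))
          + (f (y (t + 1)) - f z))
      + ∑ t ∈ Finset.range (N + 1), ∑ j ∈ Finset.range τ, α (t + 1 + j) *
          ((‖Gs (t + τ + 1) (y (t + 1))‖ ^ 2 + ‖Gs (t + 1 + j) (y (t + 1 + j))‖ ^ 2) / 2)
      + (R ^ 2 / (2 * α (τ + 1 + N)) + ∑ i ∈ Finset.range (N + 1),
          α (τ + 1 + i) / 2 * ‖Gs (τ + 1 + i) (y (τ + 1 + i))‖ ^ 2)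
      + τ * C := by
  have hreg := h.sum_regret_le (g := fun t => Gs t (y t)) hy hα hα' hmin hz
    (a := τ + 1) (by omega) N
  -- The last `τ` terms have no lagged sample within the horizon and are charged `C` each.
  have hbdry : ∑ t ∈ Finset.range τ, (f (y (N + 1 + t + 1)) - f z) ≤ τ * C := by
    refine (Finset.sum_le_sum fun t _ => hf _ (hy _ (by omega))).trans (le_of_eq ?_)
    simp
  have hmain : ∀ t, f (y (t + 1)) - f z ≤ (Fs (t + τ + 1) z - Fs (t + τ + 1) (y (t + 1))
        + (f (y (t + 1)) - f z))
      + ∑ j ∈ Finset.range τ, α (t + 1 + j) *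
          ((‖Gs (t + τ + 1) (y (t + 1))‖ ^ 2 + ‖Gs (t + 1 + j) (y (t + 1 + j))‖ ^ 2) / 2)
      + Gs (τ + 1 + t) (y (τ + 1 + t)) (y (τ + 1 + t) - z) := by
    intro t
    rw [show τ + 1 + t = t + τ + 1 by ring]
    have h1 := hsub (t + τ + 1) (y (t + τ + 1)) (hy _ (by omega)) z hz
    -- For the drift the subgradient is taken at the lagged point `y (t + 1)`, which does not depend
    -- on the later samples, so that its moments can be bounded conditionally.
    have h2 := hsub (t + τ + 1) (y (t + 1)) (hy _ (by omega)) (y (t + τ + 1)) (hy _ (by omega))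
    have h3 : Gs (t + τ + 1) (y (t + τ + 1)) (z - y (t + τ + 1)) =
        - Gs (t + τ + 1) (y (t + τ + 1)) (y (t + τ + 1) - z) := by rw [← map_neg, neg_sub]
    have h4 : -(Gs (t + τ + 1) (y (t + 1)) (y (t + τ + 1) - y (t + 1))) ≤
        ‖Gs (t + τ + 1) (y (t + 1))‖ * ‖y (t + τ + 1) - y (t + 1)‖ :=
      (neg_le_abs _).trans ((Gs (t + τ + 1) (y (t + 1))).le_opNorm _)
    have h5 := h.norm_sub_iterate_le (g := fun t => Gs t (y t)) hy hα hmin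
      (t := t + 1) (by omega) τ
    rw [show t + 1 + τ = t + τ + 1 by ring] at h5
    -- Products of norms are split into squares, so second moments suffice in expectation.
    have h6 : ‖Gs (t + τ + 1) (y (t + 1))‖ * ‖y (t + τ + 1) - y (t + 1)‖ ≤
        ∑ j ∈ Finset.range τ, α (t + 1 + j) * ((‖Gs (t + τ + 1) (y (t + 1))‖ ^ 2
          + ‖Gs (t + 1 + j) (y (t + 1 + j))‖ ^ 2) / 2) := by
      refine (mul_le_mul_of_nonneg_left h5 (norm_nonneg _)).trans ?_
      rw [Finset.mul_sum]
      refine Finset.sum_le_sum fun j _ => ?_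
      have := mul_le_mul_of_nonneg_left (two_mul_le_add_sq ‖Gs (t + τ + 1) (y (t + 1))‖
        ‖Gs (t + 1 + j) (y (t + 1 + j))‖) (hα (t + 1 + j) (by omega)).le
      linarith
    linarith
  rw [Finset.sum_range_add]
  have := Finset.sum_le_sum fun t (_ : t ∈ Finset.range (N + 1)) => hmain t
  simp only [Finset.sum_add_distrib] at this ⊢
  linarith

end Regret

/-! ### The sum of inverse square roots. -/

section StepSizes

theorem sum_range_one_div_sqrt_le (N : ℕ) :
    ∑ t ∈ Finset.range N, 1 / Real.sqrt ((t : ℝ) + 1) ≤ 2 * Real.sqrt N := by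
  induction N with
  | zero => simp
  | succ N ih =>
    rw [Finset.sum_range_succ]
    have h0 : (0 : ℝ) ≤ N := Nat.cast_nonneg N
    set a := Real.sqrt N
    set b := Real.sqrt ((N : ℝ) + 1) with hb
    have hb0 : 0 < b := Real.sqrt_pos.2 (by positivity)
    have ha0 : 0 ≤ a := Real.sqrt_nonneg _
    have ha2 : a ^ 2 = N := Real.sq_sqrt h0
    have hb2 : b ^ 2 = N + 1 := Real.sq_sqrt (by positivity)
    push_cast
    rw [← hb]
    -- Since `b² - a² = 1`, this is `(b - a)² ≥ 0`.
    have h1 : 1 / b ≤ 2 * b - 2 * a := by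
      rw [div_le_iff₀ hb0]
      nlinarith [sq_nonneg (b - a)]
    linarith

end StepSizes

/-! ### Lipschitz-type bounds and convexity of the objective. -/

section Loss

variable {E : Type*} [NormedAddCommGroup E] [NormedSpace ℝ E] [MeasurableSpace E]
  {Ξ : Type*} [MeasurableSpace Ξ] {n : ℕ} {X : Set E} {Q : Fin n → Measure Ξ}
  {F : E → Ξ → ℝ} {G : E → Ξ → StrongDual ℝ E} {R L : ℝ}

theorem IsLossFamily.sub_le (hF : IsLossFamily X Q F G) (s : Ξ) {y z : E} (hy : y ∈ X)
    (hz : z ∈ X) (hyz : ‖y - z‖ ≤ R) : F y s - F z s ≤ ‖G y s‖ * R := by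
  have h1 : F y s + G y s (z - y) ≤ F z s := hF.subgradient s y hy z hz
  have h2 : -(G y s (z - y)) ≤ ‖G y s‖ * ‖y - z‖ := by
    rw [norm_sub_rev]
    exact (neg_le_abs _).trans ((G y s).le_opNorm _)
  have h3 := mul_le_mul_of_nonneg_left hyz (norm_nonneg (G y s))
  linarith

variable [∀ i, IsProbabilityMeasure (Q i)]

theorem IsLossFamily.integral_sub_le (hF : IsLossFamily X Q F G) (hL : 0 < L) (hR : 0 ≤ R)
    (hdiam : ∀ y ∈ X, ∀ z ∈ X, ‖y - z‖ ≤ R)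
    (hsq : ∀ i, ∀ y ∈ X, Integrable (fun s => ‖G y s‖ ^ 2) (Q i) ∧
        ∫ s, ‖G y s‖ ^ 2 ∂(Q i) ≤ L ^ 2)
    (i : Fin n) {y z : E} (hy : y ∈ X) (hz : z ∈ X) :
    ∫ s, F y s ∂(Q i) - ∫ s, F z s ∂(Q i) ≤ R * L := by
  obtain ⟨hint, hle⟩ := hsq i y hy
  rw [← integral_sub (hF.integrable i y hy) (hF.integrable i z hz)]
  -- The tangent bound `‖G‖ ≤ (‖G‖² + L²) / (2L)` turns the second-moment hypothesis into a
  -- first-moment bound by `L`.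
  have hbd : Integrable (fun s => (‖G y s‖ ^ 2 + L ^ 2) * (R / (2 * L))) (Q i) :=
    (hint.add (integrable_const _)).mul_const _
  calc ∫ s, (F y s - F z s) ∂(Q i) ≤ ∫ s, (‖G y s‖ ^ 2 + L ^ 2) * (R / (2 * L)) ∂(Q i) := by
        refine integral_mono ((hF.integrable i y hy).sub (hF.integrable i z hz)) hbd fun s => ?_
        refine (hF.sub_le s hy hz (hdiam y hy z hz)).trans ?_
        have h1 : ‖G y s‖ ≤ (‖G y s‖ ^ 2 + L ^ 2) / (2 * L) := by
          rw [le_div_iff₀ (by positivity)]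
          nlinarith [sq_nonneg (‖G y s‖ - L)]
        calc ‖G y s‖ * R ≤ (‖G y s‖ ^ 2 + L ^ 2) / (2 * L) * R := by gcongr
          _ = _ := by ring
    _ = (∫ s, ‖G y s‖ ^ 2 ∂(Q i) + L ^ 2) * (R / (2 * L)) := by
        rw [integral_mul_const, integral_add hint (integrable_const _)]
        simp
    _ ≤ (L ^ 2 + L ^ 2) * (R / (2 * L)) := by gcongr
    _ = R * L := by field_simp; ring

theorem IsLossFamily.abs_integral_sub_le (hF : IsLossFamily X Q F G) (hL : 0 < L) (hR : 0 ≤ R)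
    (hdiam : ∀ y ∈ X, ∀ z ∈ X, ‖y - z‖ ≤ R)
    (hsq : ∀ i, ∀ y ∈ X, Integrable (fun s => ‖G y s‖ ^ 2) (Q i) ∧
        ∫ s, ‖G y s‖ ^ 2 ∂(Q i) ≤ L ^ 2)
    (i : Fin n) {y z : E} (hy : y ∈ X) (hz : z ∈ X) :
    |∫ s, F y s ∂(Q i) - ∫ s, F z s ∂(Q i)| ≤ R * L := by
  rw [abs_le]
  have h1 := hF.integral_sub_le hL hR hdiam hsq i hy hz
  have h2 := hF.integral_sub_le hL hR hdiam hsq i hz hy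
  constructor <;> linarith

omit [MeasurableSpace E] [∀ i, IsProbabilityMeasure (Q i)] [NormedAddCommGroup E]
  [NormedSpace ℝ E] in
theorem objective_sub_eq (y z : E) : objective Q F y - objective Q F z =
    ∑ i, (1 / (n : ℝ)) * (∫ s, F y s ∂(Q i) - ∫ s, F z s ∂(Q i)) := by
  unfold objective
  rw [← mul_sub, ← Finset.sum_sub_distrib, Finset.mul_sum]

theorem IsLossFamily.abs_objective_sub_le (hF : IsLossFamily X Q F G) (hL : 0 < L) (hR : 0 ≤ R)
    (hdiam : ∀ y ∈ X, ∀ z ∈ X, ‖y - z‖ ≤ R)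
    (hsq : ∀ i, ∀ y ∈ X, Integrable (fun s => ‖G y s‖ ^ 2) (Q i) ∧
        ∫ s, ‖G y s‖ ^ 2 ∂(Q i) ≤ L ^ 2)
    (hn : 0 < n) {y z : E} (hy : y ∈ X) (hz : z ∈ X) :
    |objective Q F y - objective Q F z| ≤ R * L := by
  rw [objective_sub_eq]
  refine (Finset.abs_sum_le_sum_abs _ _).trans ?_
  calc _ ≤ ∑ _i : Fin n, (1 / (n : ℝ)) * (R * L) := by
        refine Finset.sum_le_sum fun i _ => ?_
        rw [abs_mul, abs_of_nonneg (by positivity : (0 : ℝ) ≤ 1 / n)]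
        have := hF.abs_integral_sub_le hL hR hdiam hsq i hy hz
        gcongr
    _ = R * L := by
        have : (n : ℝ) ≠ 0 := by positivity
        rw [Finset.sum_const, Finset.card_univ, Fintype.card_fin, nsmul_eq_mul]
        field_simp

omit [∀ i, IsProbabilityMeasure (Q i)] in
theorem IsLossFamily.convexOn_objective (hF : IsLossFamily X Q F G) (hX : Convex ℝ X) :
    ConvexOn ℝ X (objective Q F) := by
  refine ⟨hX, fun y hy z hz a b ha hb hab => ?_⟩
  unfold objective
  rw [smul_eq_mul, smul_eq_mul, mul_left_comm a, mul_left_comm b, ← mul_add]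
  refine mul_le_mul_of_nonneg_left ?_ (by positivity)
  rw [Finset.mul_sum, Finset.mul_sum, ← Finset.sum_add_distrib]
  refine Finset.sum_le_sum fun i _ => ?_
  have hy' := (hF.integrable i y hy).const_mul a
  have hz' := (hF.integrable i z hz).const_mul b
  rw [← integral_const_mul, ← integral_const_mul, ← integral_add hy' hz']
  exact integral_mono (hF.integrable i _ (hX hy hz ha hb hab)) (hy'.add hz')
    fun s => (hF.convexOn s).2 hy hz ha hb hab

theorem IsLossFamily.measurable_objective (hF : IsLossFamily X Q F G) :
    Measurable (objective Q F) := by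
  unfold objective
  refine (Finset.measurable_fun_sum _ fun i _ => ?_).const_mul _
  exact (hF.measurable_loss.stronglyMeasurable.integral_prod_right (ν := Q i)).measurable

omit [∀ i, IsProbabilityMeasure (Q i)] in
theorem IsLossFamily.objective_average_sub_le (hF : IsLossFamily X Q F G) (hX : Convex ℝ X)
    {Ω : Type*} {x : ℕ → Ω → E} {ω : Ω} (hx : ∀ t, 1 ≤ t → x t ω ∈ X) {T : ℕ} (hT : 1 ≤ T)
    (z : E) :
    averageIterate x T ω ∈ X ∧
    objective Q F (averageIterate x T ω) - objective Q F z ≤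
      (1 / (T : ℝ)) * ∑ t ∈ Finset.range T, (objective Q F (x (t + 1) ω) - objective Q F z) := by
  have hT' : (T : ℝ) ≠ 0 := by positivity
  have havg : averageIterate x T ω = ∑ t ∈ Finset.range T, (1 / (T : ℝ)) • x (t + 1) ω := by
    unfold averageIterate
    rw [Finset.smul_sum, Finset.range_eq_Ico, Finset.sum_Ico_add' (fun t => (1 / (T : ℝ)) • x t ω)]
    rfl
  have hw : ∑ _t ∈ Finset.range T, 1 / (T : ℝ) = 1 := by simp [hT']
  rw [havg]
  refine ⟨hX.sum_mem (fun _ _ => by positivity) hw fun t _ => hx _ (by omega), ?_⟩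
  have h1 := (hF.convexOn_objective hX).map_sum_le (t := Finset.range T)
    (w := fun _ => 1 / (T : ℝ)) (p := fun t => x (t + 1) ω) (fun _ _ => by positivity) hw
    (fun t _ => hx _ (by omega))
  rw [Finset.sum_sub_distrib, mul_sub, Finset.mul_sum]
  have h2 : (1 / (T : ℝ)) * ∑ _t ∈ Finset.range T, objective Q F z = objective Q F z := by
    rw [Finset.sum_const, Finset.card_range, nsmul_eq_mul]
    field_simp
  rw [h2]
  simp only [smul_eq_mul] at h1
  linarith

end Loss

/-! ### The iterates are feasible and predictable. -/

section Iterates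

variable {E : Type*} [NormedAddCommGroup E] [NormedSpace ℝ E] {X : Set E} {ψ : E → ℝ} {R : ℝ}
  {Ω Ξ : Type*} {G : E → Ξ → StrongDual ℝ E} {α : ℕ → ℝ} {ξ : ℕ → Ω → Ξ} {x : ℕ → Ω → E}

theorem IsMirrorDescent.mem_of_one_le (hx : IsMirrorDescent X ψ G α ξ x) {t : ℕ} (ht : 1 ≤ t)
    (ω : Ω) : x t ω ∈ X := by
  obtain ⟨t, rfl⟩ := Nat.exists_eq_add_of_le' ht
  cases t with
  | zero =>
    obtain ⟨x₁, hx₁, h⟩ := hx.first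
    rw [zero_add, h]
    exact hx₁
  | succ t => exact hx.mem (t + 1) (by omega) ω

/-- The iterates are predictable: `x (t + 1)` is determined by the history up to time `t`. -/
theorem IsMirrorDescent.measurable_history [FiniteDimensional ℝ E] [MeasurableSpace E]
    [BorelSpace E] [MeasurableSpace Ξ] {n : ℕ} {token : ℕ → Ω → Fin n}
    (hψ : IsProxSetup X ψ R) (hG : Measurable (Function.uncurry G)) (hα : ∀ t, 1 ≤ t → 0 < α t)
    (hx : IsMirrorDescent X ψ G α ξ x) (t : ℕ) :
    Measurable[history token ξ t] (x (t + 1)) := by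
  induction t with
  | zero =>
    obtain ⟨x₁, _, h⟩ := hx.first
    rw [zero_add, show x 1 = fun _ => x₁ from funext h]
    exact measurable_const
  | succ t ih =>
    have h1 : Measurable[history token ξ (t + 1)] (x (t + 1)) :=
      ih.mono (history_mono (Nat.le_succ t)) le_rfl
    have h2 : Measurable[history token ξ (t + 1)] (ξ (t + 1)) :=
      measurable_sample_history ⟨by omega, le_rfl⟩
    have h3 : Measurable[history token ξ (t + 1)] fun ω => G (x (t + 1) ω) (ξ (t + 1) ω) :=
      hG.comp (h1.prodMk h2)
    exact @IsProxSetup.measurable_argmin E _ _ X ψ R _ _ _ hψ Ω (history token ξ (t + 1))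
      (x (t + 1)) (x (t + 1 + 1)) _ (α (t + 1)) (hα _ (by omega)) h1
      (hx.mem_of_one_le (by omega)) h3 (hx.mem (t + 1) (by omega)) (hx.argmin (t + 1) (by omega))

end Iterates

/-! ### Moment bounds from conditional laws. -/

section Moments

variable {Ω Ξ ι 𝒴 : Type*} {m mΩ : MeasurableSpace Ω} {μ : Measure Ω} [MeasurableSpace Ξ]
  [Fintype ι] [MeasurableSpace ι] [MeasurableSingletonClass ι] [MeasurableSpace 𝒴]
  {c : Ω → ι} {K : ι → Measure Ξ} {ζ : Ω → Ξ} [IsProbabilityMeasure μ]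
  [∀ i, IsProbabilityMeasure (K i)]

theorem HasCondLaw.lintegral_le (h : HasCondLaw μ m c K ζ) (hm : m ≤ mΩ) {V : Ω → 𝒴}
    (hV : Measurable[m] V) {φ : 𝒴 → Ξ → ENNReal} (hφ : Measurable (Function.uncurry φ))
    {C : ENNReal} (hle : ∀ ω, ∫⁻ s, φ (V ω) s ∂(K (c ω)) ≤ C) :
    ∫⁻ ω, φ (V ω) (ζ ω) ∂μ ≤ C := by
  rw [h.lintegral_eq hm hV hφ]
  refine (lintegral_mono hle).trans ?_
  simp

/-- A uniform bound on the conditional expectation of a nonnegative variable. -/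
theorem HasCondLaw.integrable_and_integral_le (h : HasCondLaw μ m c K ζ) (hm : m ≤ mΩ)
    {V : Ω → 𝒴} (hV : Measurable[m] V) {φ : 𝒴 → Ξ → ℝ} (hφ : Measurable (Function.uncurry φ))
    (hφ0 : ∀ y s, 0 ≤ φ y s) {C : ℝ} (hC : 0 ≤ C)
    (hint : ∀ ω, Integrable (φ (V ω)) (K (c ω))) (hle : ∀ ω, ∫ s, φ (V ω) s ∂(K (c ω)) ≤ C) :
    Integrable (fun ω => φ (V ω) (ζ ω)) μ ∧ ∫ ω, φ (V ω) (ζ ω) ∂μ ≤ C := by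
  have h1 : ∫⁻ ω, ENNReal.ofReal (φ (V ω) (ζ ω)) ∂μ ≤ ENNReal.ofReal C := by
    refine h.lintegral_le hm hV (φ := fun y s => ENNReal.ofReal (φ y s)) hφ.ennreal_ofReal
      fun ω => ?_
    rw [← ofReal_integral_eq_lintegral_ofReal (hint ω)
      (Filter.Eventually.of_forall fun s => hφ0 _ s)]
    exact ENNReal.ofReal_le_ofReal (hle ω)
  have hmeas : Measurable fun ω => φ (V ω) (ζ ω) :=
    hφ.comp ((hV.mono hm le_rfl).prodMk h.measurable)
  have h0 : 0 ≤ᵐ[μ] fun ω => φ (V ω) (ζ ω) := Filter.Eventually.of_forall fun ω => hφ0 _ _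
  refine ⟨⟨hmeas.aestronglyMeasurable, ?_⟩, ?_⟩
  · rw [hasFiniteIntegral_iff_ofReal h0]
    exact h1.trans_lt ENNReal.ofReal_lt_top
  · rw [integral_eq_lintegral_of_nonneg_ae h0 hmeas.aestronglyMeasurable]
    exact ENNReal.toReal_le_of_le_ofReal hC h1

/-- Integrability is not required: otherwise the integral is `0` by convention, and `0 ≤ C`. -/
theorem integral_le_of_forall_le {f : Ω → ℝ} {C : ℝ} (hC : 0 ≤ C) (hf : ∀ ω, f ω ≤ C) :
    ∫ ω, f ω ∂μ ≤ C := by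
  by_cases hint : Integrable f μ
  · refine (integral_mono hint (integrable_const C) hf).trans ?_
    simp
  · rw [integral_undef hint]
    exact hC

/-- A conditional exponential moment bound, after multiplication with an exponential of a variable
that is known at the time of conditioning. -/
theorem HasCondLaw.lintegral_exp_add_le (h : HasCondLaw μ m c K ζ) (hm : m ≤ mΩ) {V : Ω → 𝒴}
    (hV : Measurable[m] V) {φ : 𝒴 → Ξ → ℝ} (hφ : Measurable (Function.uncurry φ)) {C : ENNReal}
    (hle : ∀ ω, ∫⁻ s, ENNReal.ofReal (Real.exp (φ (V ω) s)) ∂(K (c ω)) ≤ C)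
    {S : Ω → ℝ} (hS : Measurable[m] S) :
    ∫⁻ ω, ENNReal.ofReal (Real.exp (S ω + φ (V ω) (ζ ω))) ∂μ ≤
      C * ∫⁻ ω, ENNReal.ofReal (Real.exp (S ω)) ∂μ := by
  -- `S` is carried along as a second frozen coordinate next to `V`.
  have hψ : Measurable (Function.uncurry fun (y : 𝒴 × ℝ) (s : Ξ) =>
      ENNReal.ofReal (Real.exp (y.2 + φ y.1 s))) := by
    have h1 : Measurable fun q : (𝒴 × ℝ) × Ξ => φ q.1.1 q.2 :=
      hφ.comp (measurable_fst.fst.prodMk measurable_snd)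
    exact (measurable_fst.snd.add h1).exp.ennreal_ofReal
  rw [h.lintegral_eq hm (hV.prodMk hS) hψ, ← lintegral_const_mul _
    (hS.mono hm le_rfl).exp.ennreal_ofReal]
  refine lintegral_mono fun ω => ?_
  have h1 : Measurable fun s => ENNReal.ofReal (Real.exp (φ (V ω) s)) :=
    (hφ.comp (measurable_const.prodMk measurable_id)).exp.ennreal_ofReal
  simp only [Real.exp_add, ENNReal.ofReal_mul (Real.exp_nonneg _)]
  rw [lintegral_const_mul _ h1, mul_comm]
  exact mul_le_mul_left (hle ω) _

/-- Hoeffding's lemma for an almost surely bounded variable with a bounded mean. -/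
theorem lintegral_exp_le_of_abs_le {ν : Measure Ξ} [IsProbabilityMeasure ν] {φ : Ξ → ℝ}
    (hφ : Measurable φ) {C b : ℝ} (hb : ∀ᵐ s ∂ν, |φ s| ≤ C) (hmean : ∫ s, φ s ∂ν ≤ b)
    {l : ℝ} (hl : 0 ≤ l) :
    ∫⁻ s, ENNReal.ofReal (Real.exp (l * (φ s - b))) ∂ν ≤
      ENNReal.ofReal (Real.exp (l ^ 2 * C ^ 2 / 2)) := by
  have hsub := hasSubgaussianMGF_of_mem_Icc hφ.aemeasurable
    (hb.mono fun s hs => (abs_le.1 hs : φ s ∈ Set.Icc (-C) C))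
  -- The range `[-C, C]` has half-length `C`, which gives the variance proxy `C²`.
  have hC : (((‖C - -C‖₊ / 2) ^ 2 : NNReal) : ℝ) = C ^ 2 := by
    push_cast
    rw [sub_neg_eq_add, Real.norm_eq_abs, div_pow, sq_abs]
    ring
  calc _ ≤ ∫⁻ s, ENNReal.ofReal (Real.exp (l * (φ s - ∫ s, φ s ∂ν))) ∂ν := by
        refine lintegral_mono fun s => ENNReal.ofReal_le_ofReal (Real.exp_le_exp.2 ?_)
        exact mul_le_mul_of_nonneg_left (by linarith) hl
    _ = ENNReal.ofReal (mgf (fun s => φ s - ∫ s, φ s ∂ν) ν l) := by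
        rw [mgf, ofReal_integral_eq_lintegral_ofReal (hsub.integrable_exp_mul l)
          (Filter.Eventually.of_forall fun s => Real.exp_nonneg _)]
    _ ≤ _ := by
        refine ENNReal.ofReal_le_ofReal ((hsub.mgf_le l).trans (le_of_eq ?_))
        rw [hC, mul_comm]

end Moments

/-! ### Calculus of integrable functions with bounded mean. -/

section MeanBounds

variable {Ω : Type*} [MeasurableSpace Ω] {μ : Measure Ω}

/-- `f` is integrable with mean at most `C`. -/
def HasMeanLE (μ : Measure Ω) (f : Ω → ℝ) (C : ℝ) : Prop :=
  Integrable f μ ∧ ∫ ω, f ω ∂μ ≤ C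

theorem HasMeanLE.add {f g : Ω → ℝ} {C D : ℝ} (hf : HasMeanLE μ f C) (hg : HasMeanLE μ g D) :
    HasMeanLE μ (fun ω => f ω + g ω) (C + D) :=
  ⟨hf.1.add hg.1, by rw [integral_add hf.1 hg.1]; exact add_le_add hf.2 hg.2⟩

theorem HasMeanLE.const_mul {f : Ω → ℝ} {C : ℝ} (hf : HasMeanLE μ f C) {a : ℝ} (ha : 0 ≤ a) :
    HasMeanLE μ (fun ω => a * f ω) (a * C) :=
  ⟨hf.1.const_mul a, by rw [integral_const_mul]; exact mul_le_mul_of_nonneg_left hf.2 ha⟩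

theorem HasMeanLE.sum {N : ℕ} {f : ℕ → Ω → ℝ} {C : ℕ → ℝ}
    (hf : ∀ i, HasMeanLE μ (f i) (C i)) :
    HasMeanLE μ (fun ω => ∑ i ∈ Finset.range N, f i ω) (∑ i ∈ Finset.range N, C i) :=
  ⟨integrable_finsetSum _ fun i _ => (hf i).1, by
    rw [integral_finsetSum _ fun i _ => (hf i).1]
    exact Finset.sum_le_sum fun i _ => (hf i).2⟩

theorem hasMeanLE_const [IsProbabilityMeasure μ] (C : ℝ) : HasMeanLE μ (fun _ => C) C :=
  ⟨integrable_const _, by simp⟩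

end MeanBounds

/-! ### Gradient bounds and the lagged sampling error. -/

section Sampling

variable {E : Type*} [NormedAddCommGroup E] [NormedSpace ℝ E] [MeasurableSpace E]
  {Ξ : Type*} [MeasurableSpace Ξ] {n : ℕ} {X : Set E} {Q : Fin n → Measure Ξ}
  {F : E → Ξ → ℝ} {G : E → Ξ → StrongDual ℝ E} {R L : ℝ} [∀ i, IsProbabilityMeasure (Q i)]

/-- Under nearly uniform weights, the mean loss difference is close to the difference of the
objective. -/
theorem IsLossFamily.integral_rowMixture_sub_le (hF : IsLossFamily X Q F G) (hL : 0 < L)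
    (hR : 0 ≤ R) (hdiam : ∀ y ∈ X, ∀ z ∈ X, ‖y - z‖ ≤ R)
    (hsq : ∀ i, ∀ y ∈ X, Integrable (fun s => ‖G y s‖ ^ 2) (Q i) ∧
        ∫ s, ‖G y s‖ ^ 2 ∂(Q i) ≤ L ^ 2)
    {p : Matrix (Fin n) (Fin n) ℝ} (hp : ∀ i j, 0 ≤ p i j) {ε : ℝ}
    (hmix : ∀ (u : Fin n → ℝ) (B : ℝ), 0 ≤ B → (∀ j, |u j| ≤ B) → ∀ i,
        |∑ j, (p i j - 1 / (n : ℝ)) * u j| ≤ ε * B)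
    (i : Fin n) {y z : E} (hy : y ∈ X) (hz : z ∈ X) :
    ∫ s, (F z s - F y s) ∂(rowMixture p Q i) ≤
      ε * (R * L) - (objective Q F y - objective Q F z) := by
  have h0 : ∀ j, Integrable (fun s => F z s - F y s) (Q j) :=
    fun j => (hF.integrable j z hz).sub (hF.integrable j y hy)
  rw [integral_rowMixture hp h0, objective_sub_eq]
  have h1 := hmix (fun j => ∫ s, F z s ∂(Q j) - ∫ s, F y s ∂(Q j)) (R * L) (by positivity)
    (fun j => hF.abs_integral_sub_le hL hR hdiam hsq j hz hy) i
  have h2 := (le_abs_self _).trans h1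
  have h3 : ∀ j, ∫ s, (F z s - F y s) ∂(Q j) = ∫ s, F z s ∂(Q j) - ∫ s, F y s ∂(Q j) :=
    fun j => integral_sub (hF.integrable j z hz) (hF.integrable j y hy)
  simp only [h3]
  have h4 : ∑ j, (p i j - 1 / (n : ℝ)) * (∫ s, F z s ∂(Q j) - ∫ s, F y s ∂(Q j)) =
      ∑ j, p i j * (∫ s, F z s ∂(Q j) - ∫ s, F y s ∂(Q j)) +
        ∑ j, 1 / (n : ℝ) * (∫ s, F y s ∂(Q j) - ∫ s, F z s ∂(Q j)) := by
    rw [← Finset.sum_add_distrib]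
    exact Finset.sum_congr rfl fun j _ => by ring
  linarith

theorem IsLossFamily.measurable_gap (hF : IsLossFamily X Q F G) (z : E) :
    Measurable (Function.uncurry fun y s =>
      F z s - F y s + (objective Q F y - objective Q F z)) := by
  have h1 : Measurable fun q : E × Ξ => F z q.2 :=
    hF.measurable_loss.comp (measurable_const.prodMk measurable_snd)
  exact (h1.sub hF.measurable_loss).add
    ((hF.measurable_objective.comp measurable_fst).sub measurable_const)

variable {Ω : Type*} [MeasurableSpace Ω] {μ : Measure Ω} [IsProbabilityMeasure μ]
  {P : Matrix (Fin n) (Fin n) ℝ} {token : ℕ → Ω → Fin n} {ξ : ℕ → Ω → Ξ} {V : Ω → E}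

/-- The weights sum to one, so mixing preserves the bound `L²` at any lag: `k = 0` serves the
gradients actually used, `k = τ` the lagged ones in the drift. -/
theorem IsTokenSampling.hasMeanLE_sq_norm [FiniteDimensional ℝ E] [BorelSpace E]
    (h : IsTokenSampling μ P Q token ξ) (hn : 2 ≤ n)
    (hP : P ∈ doublyStochastic ℝ (Fin n)) (hσ : secondSingularValue P < 1)
    (hF : IsLossFamily X Q F G)
    (hsq : ∀ i, ∀ y ∈ X, Integrable (fun s => ‖G y s‖ ^ 2) (Q i) ∧
        ∫ s, ‖G y s‖ ^ 2 ∂(Q i) ≤ L ^ 2)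
    (m k : ℕ) (hV : Measurable[history token ξ m] V) (hVX : ∀ ω, V ω ∈ X) :
    HasMeanLE μ (fun ω => ‖G (V ω) (ξ (m + k + 1) ω)‖ ^ 2) (L ^ 2) := by
  obtain ⟨c, p, hp, hp1, -, hlaw⟩ := h.exists_hasCondLaw hn hP hσ m k
  have := isProbabilityMeasure_rowMixture (Q := Q) hp hp1
  refine hlaw.integrable_and_integral_le (h.history_le m) hV
    (φ := fun y s => ‖G y s‖ ^ 2) (hF.measurable_subgradient.norm.pow_const 2)
    (fun _ _ => by positivity) (by positivity)
    (fun ω => integrable_rowMixture (fun j => (hsq j _ (hVX ω)).1) _) fun ω => ?_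
  rw [integral_rowMixture hp fun j => (hsq j _ (hVX ω)).1]
  calc _ ≤ ∑ j, p (c ω) j * L ^ 2 := Finset.sum_le_sum fun j _ =>
        mul_le_mul_of_nonneg_left (hsq j _ (hVX ω)).2 (hp _ _)
    _ = L ^ 2 := by rw [← Finset.sum_mul, hp1, one_mul]

theorem IsTokenSampling.ae_norm_le [FiniteDimensional ℝ E] [BorelSpace E]
    (h : IsTokenSampling μ P Q token ξ) (hn : 2 ≤ n)
    (hP : P ∈ doublyStochastic ℝ (Fin n)) (hσ : secondSingularValue P < 1)
    (hF : IsLossFamily X Q F G) (hbd : ∀ i, ∀ y ∈ X, ∀ᵐ s ∂(Q i), ‖G y s‖ ≤ L)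
    (m k : ℕ) (hV : Measurable[history token ξ m] V) (hVX : ∀ ω, V ω ∈ X) :
    ∀ᵐ ω ∂μ, ‖G (V ω) (ξ (m + k + 1) ω)‖ ≤ L := by
  obtain ⟨c, p, hp, hp1, -, hlaw⟩ := h.exists_hasCondLaw hn hP hσ m k
  have := isProbabilityMeasure_rowMixture (Q := Q) hp hp1
  exact hlaw.ae_of_forall_ae (h.history_le m) hV (p := fun y s => ‖G y s‖ ≤ L)
    (measurableSet_le hF.measurable_subgradient.norm measurable_const)
    fun ω => ae_rowMixture (fun j => hbd j _ (hVX ω)) _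

/-- The mean sampling error after `k + 1` steps of the chain is of the order `σ₂ ^ k`. -/
theorem IsTokenSampling.hasMeanLE_gap [FiniteDimensional ℝ E] [BorelSpace E]
    (h : IsTokenSampling μ P Q token ξ) (hn : 2 ≤ n)
    (hP : P ∈ doublyStochastic ℝ (Fin n)) (hσ : secondSingularValue P < 1)
    (hF : IsLossFamily X Q F G) (hL : 0 < L)
    (hR : 0 ≤ R) (hdiam : ∀ y ∈ X, ∀ z ∈ X, ‖y - z‖ ≤ R)
    (hsq : ∀ i, ∀ y ∈ X, Integrable (fun s => ‖G y s‖ ^ 2) (Q i) ∧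
        ∫ s, ‖G y s‖ ^ 2 ∂(Q i) ≤ L ^ 2)
    (m k : ℕ) (hV : Measurable[history token ξ m] V) (hVX : ∀ ω, V ω ∈ X) {z : E} (hz : z ∈ X) :
    HasMeanLE μ (fun ω => F z (ξ (m + k + 1) ω) - F (V ω) (ξ (m + k + 1) ω)
      + (objective Q F (V ω) - objective Q F z))
      (Real.sqrt n * secondSingularValue P ^ k * (R * L)) := by
  have hσ0 : 0 ≤ secondSingularValue P := (Matrix.toEuclideanLin P).singularValues_nonneg 1
  have hG1 := (h.hasMeanLE_sq_norm hn hP hσ hF hsq m k hV hVX).1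
  have hG2 := (h.hasMeanLE_sq_norm hn hP hσ hF hsq m k (V := fun _ => z)
    measurable_const fun _ => hz).1
  obtain ⟨c, p, hp, hp1, hmix, hlaw⟩ := h.exists_hasCondLaw hn hP hσ m k
  have := isProbabilityMeasure_rowMixture (Q := Q) hp hp1
  have hm := h.history_le m
  have hgap := hF.measurable_gap z
  have hint : Integrable (fun ω => F z (ξ (m + k + 1) ω) - F (V ω) (ξ (m + k + 1) ω)
      + (objective Q F (V ω) - objective Q F z)) μ := by
    -- The inequality `a ≤ a² + 1` gives domination by the integrable squared norms.
    have hdom : Integrable (fun ω => (‖G z (ξ (m + k + 1) ω)‖ ^ 2 + 1) * R +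
        (‖G (V ω) (ξ (m + k + 1) ω)‖ ^ 2 + 1) * R + R * L) μ :=
      (((hG2.add (integrable_const _)).mul_const R).add
        ((hG1.add (integrable_const _)).mul_const R)).add (integrable_const _)
    refine hdom.mono' (hgap.comp ((hV.mono hm le_rfl).prodMk
      (h.measurable_sample (m + k + 1)))).aestronglyMeasurable
      (Filter.Eventually.of_forall fun ω => ?_)
    have h1 := hF.sub_le (ξ (m + k + 1) ω) hz (hVX ω) (hdiam z hz _ (hVX ω))
    have h2 := hF.sub_le (ξ (m + k + 1) ω) (hVX ω) hz (hdiam _ (hVX ω) z hz)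
    have h3 := abs_le.1 (hF.abs_objective_sub_le hL hR hdiam hsq (by omega) (hVX ω) hz)
    have h4 : ∀ a : ℝ, 0 ≤ a → a * R ≤ (a ^ 2 + 1) * R := fun a _ =>
      mul_le_mul_of_nonneg_right (by nlinarith [sq_nonneg (a - 1)]) hR
    have h5 := h4 _ (norm_nonneg (G z (ξ (m + k + 1) ω)))
    have h6 := h4 _ (norm_nonneg (G (V ω) (ξ (m + k + 1) ω)))
    have h7 := mul_nonneg (norm_nonneg (G z (ξ (m + k + 1) ω))) hR
    have h8 := mul_nonneg (norm_nonneg (G (V ω) (ξ (m + k + 1) ω))) hR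
    rw [Real.norm_eq_abs, abs_le]
    constructor <;> linarith
  refine ⟨hint, ?_⟩
  rw [hlaw.integral_eq hm hV hgap hint]
  refine integral_le_of_forall_le (by positivity) fun ω => ?_
  have h1 := integrable_rowMixture (p := p)
    (fun j => (hF.integrable j z hz).sub (hF.integrable j _ (hVX ω))) (c ω)
  have h2 := hF.integral_rowMixture_sub_le hL hR hdiam hsq hp hmix (c ω) (hVX ω) hz
  have h3 := integral_add h1 (integrable_const (objective Q F (V ω) - objective Q F z))
  simp only [Pi.sub_apply, integral_const, probReal_univ, smul_eq_mul, one_mul] at h3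
  rw [h3]
  linarith

/-- The sampling error after `k + 1` steps of the chain is conditionally sub-Gaussian. -/
theorem IsTokenSampling.lintegral_exp_gap_le
    (h : IsTokenSampling μ P Q token ξ) (hn : 2 ≤ n)
    (hP : P ∈ doublyStochastic ℝ (Fin n)) (hσ : secondSingularValue P < 1)
    (hF : IsLossFamily X Q F G) (hL : 0 < L)
    (hR : 0 ≤ R) (hdiam : ∀ y ∈ X, ∀ z ∈ X, ‖y - z‖ ≤ R)
    (hsq : ∀ i, ∀ y ∈ X, Integrable (fun s => ‖G y s‖ ^ 2) (Q i) ∧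
        ∫ s, ‖G y s‖ ^ 2 ∂(Q i) ≤ L ^ 2)
    (hbd : ∀ i, ∀ y ∈ X, ∀ᵐ s ∂(Q i), ‖G y s‖ ≤ L)
    (m k : ℕ) (hV : Measurable[history token ξ m] V) (hVX : ∀ ω, V ω ∈ X) {z : E} (hz : z ∈ X)
    {l : ℝ} (hl : 0 ≤ l) {S : Ω → ℝ} (hS : Measurable[history token ξ m] S) :
    ∫⁻ ω, ENNReal.ofReal (Real.exp (S ω + l * (F z (ξ (m + k + 1) ω) - F (V ω) (ξ (m + k + 1) ω)
      + (objective Q F (V ω) - objective Q F z)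
      - Real.sqrt n * secondSingularValue P ^ k * (R * L)))) ∂μ ≤
    ENNReal.ofReal (Real.exp (l ^ 2 * (R * L) ^ 2 / 2)) *
      ∫⁻ ω, ENNReal.ofReal (Real.exp (S ω)) ∂μ := by
  obtain ⟨c, p, hp, hp1, hmix, hlaw⟩ := h.exists_hasCondLaw hn hP hσ m k
  have := isProbabilityMeasure_rowMixture (Q := Q) hp hp1
  refine hlaw.lintegral_exp_add_le (h.history_le m) hV (φ := fun y s => l * (F z s - F y s
    + (objective Q F y - objective Q F z) - Real.sqrt n * secondSingularValue P ^ k * (R * L)))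
    (((hF.measurable_gap z).sub_const _).const_mul l) (fun ω => ?_) hS
  have hmean := hF.integral_rowMixture_sub_le hL hR hdiam hsq hp hmix (c ω) (hVX ω) hz
  have hmeas : Measurable fun s => F z s - F (V ω) s :=
    (hF.measurable_loss.comp (measurable_const.prodMk measurable_id)).sub
      (hF.measurable_loss.comp (measurable_const.prodMk measurable_id))
  -- With `V ω` frozen only `F z s - F (V ω) s` is random, with range in `[-RL, RL]`; the objective
  -- difference and the bias are constants and enter through the mean bound.
  have habs : ∀ᵐ s ∂(rowMixture p Q (c ω)), |F z s - F (V ω) s| ≤ R * L := by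
    refine ae_rowMixture (fun j => ?_) _
    filter_upwards [hbd j z hz, hbd j _ (hVX ω)] with s h1 h2
    have h3 := hF.sub_le s hz (hVX ω) (hdiam z hz _ (hVX ω))
    have h4 := hF.sub_le s (hVX ω) hz (hdiam _ (hVX ω) z hz)
    have h5 := mul_le_mul_of_nonneg_right h1 hR
    have h6 := mul_le_mul_of_nonneg_right h2 hR
    rw [abs_le]
    constructor <;> linarith
  refine le_trans (le_of_eq ?_) (lintegral_exp_le_of_abs_le hmeas habs hmean hl)
  refine lintegral_congr fun s => ?_
  congr 3
  ring

end Sampling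

/-! ### Mixing time and the budget of constants. -/

section Constants

variable {n : ℕ} {P : Matrix (Fin n) (Fin n) ℝ} {T : ℕ}

theorem log_two_le_tauMix (hn : 2 ≤ n) (hσ : secondSingularValue P < 1) (hT : 1 ≤ T) :
    Real.log (T * 2) ≤ tauMix P T := by
  have hσ0 : 0 ≤ secondSingularValue P := (Matrix.toEuclideanLin P).singularValues_nonneg 1
  have hn' : (2 : ℝ) ≤ n := by exact_mod_cast hn
  have hT' : (1 : ℝ) ≤ T := by exact_mod_cast hT
  have h1 : Real.log (T * 2) ≤ Real.log (T * n) :=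
    Real.log_le_log (by positivity) (by gcongr)
  have h2 : 0 ≤ Real.log ((T : ℝ) * n) := Real.log_nonneg (by nlinarith)
  unfold tauMix
  rw [le_div_iff₀ (by linarith)]
  nlinarith [Real.log_nonneg (by linarith : (1 : ℝ) ≤ T * 2)]

/-- From `σ₂ ≤ exp (-(1 - σ₂))` and `τ ≥ tauMix P T - 1` follows `σ₂ ^ τ ≤ e / (T n)`: the floor
costs a factor at most `e`. What remains is `e / √n ≤ e / √2 < 2`. -/
theorem mixing_error_le (hn : 2 ≤ n) (hσ : secondSingularValue P < 1) (hT : 1 ≤ T) :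
    (T : ℝ) * (Real.sqrt n * secondSingularValue P ^ ⌊tauMix P T⌋₊) ≤ 2 := by
  have hσ0 : 0 ≤ secondSingularValue P := (Matrix.toEuclideanLin P).singularValues_nonneg 1
  have hn' : (2 : ℝ) ≤ n := by exact_mod_cast hn
  have hT' : (1 : ℝ) ≤ T := by exact_mod_cast hT
  set σ := secondSingularValue P
  set τ := ⌊tauMix P T⌋₊
  have hτ : tauMix P T - 1 ≤ τ := (Nat.sub_one_lt_floor _).le
  have h1 : σ ^ τ ≤ Real.exp 1 / (T * n) := by
    have h2 : σ ≤ Real.exp (-(1 - σ)) := by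
      have := Real.add_one_le_exp (-(1 - σ))
      linarith
    calc σ ^ τ ≤ Real.exp (-(1 - σ)) ^ τ := pow_le_pow_left₀ hσ0 h2 τ
      _ = Real.exp (-((1 - σ) * τ)) := by rw [← Real.exp_nat_mul]; congr 1; ring
      _ ≤ Real.exp (1 - Real.log (T * n)) := by
          refine Real.exp_le_exp.2 ?_
          have h3 : (1 - σ) * tauMix P T = Real.log (T * n) := by
            unfold tauMix
            exact mul_div_cancel₀ _ (by linarith : (1 - σ) ≠ 0)
          nlinarith
      _ = Real.exp 1 / (T * n) := by rw [Real.exp_sub, Real.exp_log (by positivity)]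
  have hs : 0 < Real.sqrt n := Real.sqrt_pos.2 (by linarith)
  have hs2 : Real.sqrt n * Real.sqrt n = n := Real.mul_self_sqrt (by linarith)
  calc (T : ℝ) * (Real.sqrt n * σ ^ τ) ≤ T * (Real.sqrt n * (Real.exp 1 / (T * n))) := by gcongr
    _ = Real.exp 1 / Real.sqrt n := by
        field_simp
        rw [sq, hs2]
    _ ≤ 2 := by
        rw [div_le_iff₀ hs]
        have h3 := Real.exp_one_lt_d9
        have h4 := Real.exp_pos 1
        nlinarith

/-- The contributions of drift, regret and boundary to the optimality gap, for the step sizes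
`R / (L √τ) / √t`. -/
theorem gap_budget_le {R L θ : ℝ} (hR : 0 < R) (hL : 0 < L) (hθ : 0 < θ) {τ N : ℕ}
    (hτ : (τ : ℝ) ≤ θ) {α : ℕ → ℝ} (hα : α = fun t : ℕ => R / (L * Real.sqrt θ) / Real.sqrt t) :
    ∑ t ∈ Finset.range (N + 1), ∑ j ∈ Finset.range τ, α (t + 1 + j) * L ^ 2
      + (R ^ 2 / (2 * α (τ + 1 + N)) + ∑ i ∈ Finset.range (N + 1), α (τ + 1 + i) / 2 * L ^ 2)
      + τ * (R * L) ≤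
    5 / 2 * (R * L) * Real.sqrt θ * Real.sqrt (N + 1 + τ : ℕ)
      + R * L * Real.sqrt (N + 1 + τ : ℕ) / Real.sqrt θ + R * L * θ := by
  have hsθ : 0 < Real.sqrt θ := Real.sqrt_pos.2 hθ
  have hsθ2 : Real.sqrt θ ^ 2 = θ := Real.sq_sqrt hθ.le
  set a := R / (L * Real.sqrt θ) with ha
  have ha0 : 0 < a := by positivity
  set S := Real.sqrt (N + 1 + τ : ℕ) with hS
  have hS0 : 0 < S := Real.sqrt_pos.2 (by positivity)
  have hα1 : ∀ t i : ℕ, α (t + 1 + i) ≤ a * (1 / Real.sqrt ((t : ℝ) + 1)) := by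
    intro t i
    rw [hα]
    simp only
    rw [div_eq_mul_one_div a]
    push_cast
    have h1 : (t : ℝ) + 1 ≤ t + 1 + i := by linarith [Nat.cast_nonneg (α := ℝ) i]
    have h2 : 0 < Real.sqrt ((t : ℝ) + 1) := Real.sqrt_pos.2 (by positivity)
    gcongr
  have hsum : ∑ t ∈ Finset.range (N + 1), a * (1 / Real.sqrt ((t : ℝ) + 1)) ≤ a * (2 * S) := by
    rw [← Finset.mul_sum]
    refine mul_le_mul_of_nonneg_left ((sum_range_one_div_sqrt_le (N + 1)).trans ?_) ha0.le
    rw [hS]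
    have : Real.sqrt (N + 1 : ℕ) ≤ Real.sqrt (N + 1 + τ : ℕ) :=
      Real.sqrt_le_sqrt (by exact_mod_cast Nat.le_add_right (N + 1) τ)
    linarith
  -- The leading constant `5/2` is `2` from the drift here and `1/2` from the Bregman term in the
  -- next claim; the step size `R / (L√θ)` gives both the order `√θ`.
  have h1 : ∑ t ∈ Finset.range (N + 1), ∑ j ∈ Finset.range τ, α (t + 1 + j) * L ^ 2 ≤
      2 * (R * L) * Real.sqrt θ * S := by
    calc _ ≤ ∑ t ∈ Finset.range (N + 1), ∑ _j ∈ Finset.range τ,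
            a * (1 / Real.sqrt ((t : ℝ) + 1)) * L ^ 2 :=
          Finset.sum_le_sum fun t _ => Finset.sum_le_sum fun j _ =>
            mul_le_mul_of_nonneg_right (hα1 t j) (by positivity)
      _ = (∑ t ∈ Finset.range (N + 1), a * (1 / Real.sqrt ((t : ℝ) + 1))) * (τ * L ^ 2) := by
          rw [Finset.sum_mul]
          refine Finset.sum_congr rfl fun t _ => ?_
          rw [Finset.sum_const, Finset.card_range, nsmul_eq_mul]
          ring
      _ ≤ a * (2 * S) * (θ * L ^ 2) := by gcongr
      _ = _ := by
          rw [ha]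
          field_simp
          rw [hsθ2]
  have h2 : R ^ 2 / (2 * α (τ + 1 + N)) = 1 / 2 * (R * L) * Real.sqrt θ * S := by
    have : α (τ + 1 + N) = a / S := by
      rw [hα, hS]
      simp only
      rw [show τ + 1 + N = N + 1 + τ by ring]
    rw [this, ha]
    field_simp
  have h3 : ∑ i ∈ Finset.range (N + 1), α (τ + 1 + i) / 2 * L ^ 2 ≤ R * L * S / Real.sqrt θ := by
    calc _ ≤ ∑ i ∈ Finset.range (N + 1), a * (1 / Real.sqrt ((i : ℝ) + 1)) / 2 * L ^ 2 := by
          refine Finset.sum_le_sum fun i _ => ?_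
          have := hα1 i τ
          rw [show i + 1 + τ = τ + 1 + i by ring] at this
          gcongr
      _ = (∑ i ∈ Finset.range (N + 1), a * (1 / Real.sqrt ((i : ℝ) + 1))) * (L ^ 2 / 2) := by
          rw [Finset.sum_mul]
          exact Finset.sum_congr rfl fun t _ => by ring
      _ ≤ a * (2 * S) * (L ^ 2 / 2) := by gcongr
      _ = _ := by
          rw [ha]
          field_simp
  have h4 : τ * (R * L) ≤ R * L * θ := by
    rw [mul_comm (R * L)]
    gcongr
  linarith

end Constants

/-! ### The two bounds for the averaged iterate. -/

section Assembly

variable {E : Type*} [NormedAddCommGroup E] [NormedSpace ℝ E] [FiniteDimensional ℝ E]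
  [MeasurableSpace E] [BorelSpace E] {Ξ : Type*} [MeasurableSpace Ξ]
  {Ω : Type*} [MeasurableSpace Ω] {μ : Measure Ω} [IsProbabilityMeasure μ]
  {X : Set E} {ψ : E → ℝ} {R L : ℝ} {n : ℕ} {P : Matrix (Fin n) (Fin n) ℝ}
  {Q : Fin n → Measure Ξ} [∀ i, IsProbabilityMeasure (Q i)]
  {F : E → Ξ → ℝ} {G : E → Ξ → StrongDual ℝ E} {token : ℕ → Ω → Fin n} {ξ : ℕ → Ω → Ξ}
  {x : ℕ → Ω → E} {T : ℕ}

theorem stepSize_pos {θ : ℝ} (hR : 0 < R) (hL : 0 < L) (hθ : 0 < θ) (t : ℕ) (ht : 1 ≤ t) :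
    0 < R / (L * Real.sqrt θ) / Real.sqrt (t : ℝ) := by
  have := Real.sqrt_pos.2 hθ
  have : 0 < Real.sqrt (t : ℝ) := Real.sqrt_pos.2 (by exact_mod_cast ht)
  positivity

theorem stepSize_succ_le {θ : ℝ} (hR : 0 < R) (hL : 0 < L) (hθ : 0 < θ) (t : ℕ) (ht : 1 ≤ t) :
    R / (L * Real.sqrt θ) / Real.sqrt ((t + 1 : ℕ) : ℝ) ≤
      R / (L * Real.sqrt θ) / Real.sqrt (t : ℝ) := by
  have := Real.sqrt_pos.2 hθ
  have : 0 < Real.sqrt (t : ℝ) := Real.sqrt_pos.2 (by exact_mod_cast ht)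
  push_cast
  gcongr
  linarith

/-- The hypothesis forces `log (2T) ≤ T / 2`, that is `(2T)² ≤ e ^ T`, which fails for `T = 1, 2,
3`. Then `tauMix P T ≥ log 8 ≥ 1`. -/
theorem four_le_and_one_le_tauMix (hn : 2 ≤ n) (hσ : secondSingularValue P < 1) (hT : 1 ≤ T)
    (h : tauMix P T ≤ (T : ℝ) / 2) : 4 ≤ T ∧ 1 ≤ tauMix P T := by
  have h1 := log_two_le_tauMix hn hσ hT
  have h2 : Real.exp 1 < 2.7182818286 := Real.exp_one_lt_d9
  have h0 := Real.exp_pos 1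
  have hT4 : 4 ≤ T := by
    by_contra hlt
    have h3 : Real.log (T * 2) ≤ T / 2 := h1.trans h
    have hT0 : (0 : ℝ) < T := by exact_mod_cast hT
    have h4 : ((T : ℝ) * 2) ^ 2 ≤ Real.exp 1 ^ T := by
      have h5 := Real.exp_le_exp.2 h3
      rw [Real.exp_log (by positivity)] at h5
      have h6 := pow_le_pow_left₀ (by positivity) h5 2
      refine h6.trans (le_of_eq ?_)
      rw [← Real.exp_nat_mul, ← Real.exp_nat_mul]
      congr 1
      push_cast
      ring
    generalize Real.exp 1 = e at *
    interval_cases T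
    · norm_num at h4
      linarith
    · norm_num at h4
      nlinarith
    · norm_num at h4
      have : e ^ 3 ≤ 2.7182818286 ^ 3 := pow_le_pow_left₀ h0.le h2.le 3
      norm_num at this
      linarith
  refine ⟨hT4, le_trans ?_ h1⟩
  have hT4' : (4 : ℝ) ≤ T := by exact_mod_cast hT4
  rw [Real.le_log_iff_exp_le (by positivity)]
  linarith

omit [FiniteDimensional ℝ E] [BorelSpace E] in
theorem IsLossFamily.sq_norm_of_ae_norm_le (hF : IsLossFamily X Q F G) (i : Fin n) {y : E}
    (h : ∀ᵐ s ∂(Q i), ‖G y s‖ ≤ L) :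
    Integrable (fun s => ‖G y s‖ ^ 2) (Q i) ∧ ∫ s, ‖G y s‖ ^ 2 ∂(Q i) ≤ L ^ 2 := by
  have hmeas : Measurable fun s => ‖G y s‖ ^ 2 :=
    ((hF.measurable_subgradient.comp (measurable_const.prodMk measurable_id)).norm).pow_const 2
  have hle : ∀ᵐ s ∂(Q i), ‖G y s‖ ^ 2 ≤ L ^ 2 :=
    h.mono fun s hs => pow_le_pow_left₀ (norm_nonneg _) hs 2
  have hint : Integrable (fun s => ‖G y s‖ ^ 2) (Q i) := by
    refine (integrable_const (L ^ 2)).mono' hmeas.aestronglyMeasurable (hle.mono fun s hs => ?_)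
    rwa [Real.norm_eq_abs, abs_of_nonneg (by positivity)]
  refine ⟨hint, (integral_mono_ae hint (integrable_const _) hle).trans ?_⟩
  simp

/-- The expected optimality gap of the averaged iterate. -/
theorem integral_objective_average_le (hR : 0 < R) (hL : 0 < L) (hψ : IsProxSetup X ψ R)
    (hn : 2 ≤ n) (hP : P ∈ doublyStochastic ℝ (Fin n)) (hσ : secondSingularValue P < 1)
    (hF : IsLossFamily X Q F G) (hξ : IsTokenSampling μ P Q token ξ) (hT : 1 ≤ T)
    (hx : IsMirrorDescent X ψ G
      (fun t => (R / (L * Real.sqrt (tauMix P T))) / Real.sqrt (t : ℝ)) ξ x)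
    {z : E} (hz : z ∈ X)
    (hsq : ∀ i, ∀ y ∈ X, Integrable (fun s => ‖G y s‖ ^ 2) (Q i) ∧
        ∫ s, ‖G y s‖ ^ 2 ∂(Q i) ≤ L ^ 2) :
    Integrable (fun ω => objective Q F (averageIterate x T ω)) μ ∧
      (∫ ω, objective Q F (averageIterate x T ω) ∂μ) - objective Q F z ≤
        5 * R * L / 2 * (Real.sqrt (tauMix P T) / Real.sqrt (T : ℝ))
          + 5 * R * L / Real.sqrt (T : ℝ)
          + R * L / (T : ℝ) * tauMix P T := by
  set θ := tauMix P T with hθdef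
  have hT1 : (1 : ℝ) ≤ T := by exact_mod_cast hT
  have hθ2 : 0.6931 < θ := by
    have h1 := log_two_le_tauMix hn hσ hT
    have h2 : Real.log 2 ≤ Real.log (T * 2) := Real.log_le_log (by norm_num) (by linarith)
    have := Real.log_two_gt_d9
    linarith
  have hθ : 0 < θ := by linarith
  set α : ℕ → ℝ := fun t => R / (L * Real.sqrt θ) / Real.sqrt (t : ℝ) with hα
  have hαpos : ∀ t, 1 ≤ t → 0 < α t := stepSize_pos hR hL hθ
  have hdiam : ∀ y ∈ X, ∀ z ∈ X, ‖y - z‖ ≤ R := fun y hy z hz => hψ.norm_sub_le hR.le hy hz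
  have hxX : ∀ t, 1 ≤ t → ∀ ω, x t ω ∈ X := fun t ht => hx.mem_of_one_le ht
  have hxm : ∀ t, Measurable[history token ξ t] (x (t + 1)) :=
    hx.measurable_history hψ hF.measurable_subgradient hαpos
  have hxm' : ∀ t, 1 ≤ t → Measurable (x t) := by
    intro t ht
    obtain ⟨t, rfl⟩ := Nat.exists_eq_add_of_le' ht
    exact (hxm t).mono (hξ.history_le t) le_rfl
  have hobj : ∀ y ∈ X, |objective Q F y - objective Q F z| ≤ R * L := fun y hy =>
    hF.abs_objective_sub_le hL hR.le hdiam hsq (by omega) hy hz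
  have havg := fun ω => hF.objective_average_sub_le hψ.convex (fun t ht => hxX t ht ω) hT z
  have hmeas : Measurable fun ω => objective Q F (averageIterate x T ω) := by
    refine hF.measurable_objective.comp ?_
    unfold averageIterate
    exact (Finset.measurable_fun_sum _ fun t ht =>
      hxm' t (Finset.mem_Icc.1 ht).1).const_smul (1 / (T : ℝ))
  have hint : Integrable (fun ω => objective Q F (averageIterate x T ω)) μ := by
    refine (integrable_const (R * L + |objective Q F z|)).mono' hmeas.aestronglyMeasurable
      (Filter.Eventually.of_forall fun ω => ?_)
    have h1 := hobj _ (havg ω).1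
    have h2 := abs_sub_abs_le_abs_sub (objective Q F (averageIterate x T ω)) (objective Q F z)
    rw [Real.norm_eq_abs]
    linarith
  refine ⟨hint, ?_⟩
  have hsT : 0 < Real.sqrt (T : ℝ) := Real.sqrt_pos.2 (by linarith)
  have hsT2 : Real.sqrt (T : ℝ) ^ 2 = T := Real.sq_sqrt (by linarith)
  have hsθ : 0 < Real.sqrt θ := Real.sqrt_pos.2 hθ
  -- It is enough to bound `T` times the gap by an integrable pathwise majorant.
  suffices hbound : ∃ D : Ω → ℝ, (∀ ω, ∑ t ∈ Finset.range T,
      (objective Q F (x (t + 1) ω) - objective Q F z) ≤ D ω) ∧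
      HasMeanLE μ D (5 / 2 * (R * L) * Real.sqrt θ * Real.sqrt T
        + 5 * (R * L) * Real.sqrt T + R * L * θ) by
    obtain ⟨D, hD, hDm⟩ := hbound
    have h1 : (∫ ω, objective Q F (averageIterate x T ω) ∂μ) - objective Q F z =
        ∫ ω, (objective Q F (averageIterate x T ω) - objective Q F z) ∂μ := by
      rw [integral_sub hint (integrable_const _)]
      simp
    have h2 := hDm.const_mul (a := 1 / (T : ℝ)) (by positivity)
    rw [h1]
    calc _ ≤ ∫ ω, 1 / (T : ℝ) * D ω ∂μ :=
          integral_mono (hint.sub (integrable_const _)) h2.1 fun ω =>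
            (havg ω).2.trans (mul_le_mul_of_nonneg_left (hD ω) (by positivity))
      _ ≤ _ := h2.2
      _ = _ := by
          rw [← hsT2]
          field_simp
          rw [Real.sqrt_sq hsT.le]
          ring
  set τ := ⌊θ⌋₊ with hτdef
  have hτ : (τ : ℝ) ≤ θ := Nat.floor_le hθ.le
  by_cases hcase : T ≤ τ
  -- When `T ≤ τ` no lagged sample is available, but the trivial bound `T R L ≤ R L θ` already fits
  -- in the last term.
  · refine ⟨fun _ => T * (R * L), fun ω => ?_, integrable_const _, ?_⟩
    · refine (Finset.sum_le_sum fun t _ => (le_abs_self _).trans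
        (hobj _ (hxX (t + 1) (by omega) ω))).trans (le_of_eq ?_)
      simp
    · simp only [integral_const, probReal_univ, one_smul]
      have h1 : (T : ℝ) ≤ θ := le_trans (by exact_mod_cast hcase) hτ
      have h2 : (T : ℝ) * (R * L) ≤ R * L * θ := by rw [mul_comm]; gcongr
      have h3 : 0 ≤ 5 / 2 * (R * L) * Real.sqrt θ * Real.sqrt T + 5 * (R * L) * Real.sqrt T := by
        positivity
      linarith
  · obtain ⟨N, hN⟩ : ∃ N, T = N + 1 + τ := ⟨T - τ - 1, by omega⟩
    have hsqm : ∀ t k, HasMeanLE μ (fun ω => ‖G (x (t + 1) ω) (ξ (t + k + 1) ω)‖ ^ 2) (L ^ 2) :=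
      fun t k => hξ.hasMeanLE_sq_norm hn hP hσ hF hsq t k (hxm t) (hxX (t + 1) (by omega))
    have hsqm' : ∀ t, 1 ≤ t → HasMeanLE μ (fun ω => ‖G (x t ω) (ξ t ω)‖ ^ 2) (L ^ 2) := by
      intro t ht
      obtain ⟨t, rfl⟩ := Nat.exists_eq_add_of_le' ht
      exact hsqm t 0
    have h1 := HasMeanLE.sum (N := N + 1) fun t => hξ.hasMeanLE_gap hn hP hσ hF hL hR.le hdiam
      hsq t τ (hxm t) (hxX (t + 1) (by omega)) hz
    have h2 := HasMeanLE.sum (N := N + 1) fun t => HasMeanLE.sum (N := τ) fun j =>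
      (((hsqm t τ).add (hsqm' (t + 1 + j) (by omega))).const_mul
        (by norm_num : (0 : ℝ) ≤ 1 / 2)).const_mul (hαpos (t + 1 + j) (by omega)).le
    have h3 := (hasMeanLE_const (μ := μ) (R ^ 2 / (2 * α (τ + 1 + N)))).add
      (HasMeanLE.sum (N := N + 1) fun i => (hsqm' (τ + 1 + i) (by omega)).const_mul
        (half_pos (hαpos (τ + 1 + i) (by omega))).le)
    have h4 := ((h1.add h2).add h3).add (hasMeanLE_const (μ := μ) (τ * (R * L)))
    refine ⟨_, fun ω => ?_, h4.1, h4.2.trans ?_⟩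
    · have := hψ.sum_gap_le (y := fun t => x t ω) (α := α) (Fs := fun t y => F y (ξ t ω))
        (Gs := fun t y => G y (ξ t ω)) (fun t ht => hxX t ht ω) hαpos
        (stepSize_succ_le hR hL hθ)
        (fun t => hF.subgradient (ξ t ω)) (fun t ht => hx.argmin t ht ω) hz
        (fun w hw => (le_abs_self _).trans (hobj w hw)) τ N
      rw [← hN] at this
      simpa only [one_div, div_eq_inv_mul, mul_one] using this
    · have h5 := gap_budget_le (N := N) hR hL hθ hτ hα
      have h6 := mixing_error_le hn hσ hT
      rw [← hθdef, ← hτdef] at h6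
      rw [← hN] at h5
      -- The coefficient of `RL√T` is `2` from mixing and `2` from the squared gradients in the
      -- regret, since `θ > 1/4`; this is within the stated `5`.
      have h7 : 1 / Real.sqrt θ ≤ 2 := by
        rw [div_le_iff₀ hsθ]
        have : (1 / 2 : ℝ) ≤ Real.sqrt θ := Real.le_sqrt_of_sq_le (by norm_num; linarith)
        linarith
      have h8 : 1 ≤ Real.sqrt (T : ℝ) := Real.one_le_sqrt.2 hT1
      have hσ0 : 0 ≤ secondSingularValue P := (Matrix.toEuclideanLin P).singularValues_nonneg 1
      have hRL : 0 < R * L := by positivity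
      have h9 : ∑ _t ∈ Finset.range (N + 1),
          Real.sqrt n * secondSingularValue P ^ τ * (R * L) ≤ 2 * (R * L) * Real.sqrt T := by
        have hNT : ((N + 1 : ℕ) : ℝ) ≤ T := by exact_mod_cast (by omega : N + 1 ≤ T)
        rw [Finset.sum_const, Finset.card_range, nsmul_eq_mul]
        calc _ ≤ (T : ℝ) * (Real.sqrt n * secondSingularValue P ^ τ * (R * L)) := by gcongr
          _ = (T : ℝ) * (Real.sqrt n * secondSingularValue P ^ τ) * (R * L) := by ring
          _ ≤ 2 * (R * L) := by gcongr
          _ ≤ 2 * (R * L) * Real.sqrt T := le_mul_of_one_le_right (by positivity) h8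
      have h10 : R * L * Real.sqrt T / Real.sqrt θ ≤ 2 * (R * L) * Real.sqrt T := by
        rw [div_eq_mul_one_div]
        calc _ ≤ R * L * Real.sqrt T * 2 := by gcongr
          _ = _ := by ring
      have h11 : ∀ t j : ℕ, α (t + 1 + j) * (1 / 2 * (L ^ 2 + L ^ 2)) = α (t + 1 + j) * L ^ 2 :=
        fun t j => by ring
      simp only [h11]
      have h12 : 0 ≤ R * L * Real.sqrt T := by positivity
      linarith

/-- The optimality gap of the averaged iterate with high probability. -/
theorem measureReal_objective_average_le (hR : 0 < R) (hL : 0 < L) (hψ : IsProxSetup X ψ R)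
    (hn : 2 ≤ n) (hP : P ∈ doublyStochastic ℝ (Fin n)) (hσ : secondSingularValue P < 1)
    (hF : IsLossFamily X Q F G) (hξ : IsTokenSampling μ P Q token ξ) (hT : 1 ≤ T)
    (hx : IsMirrorDescent X ψ G
      (fun t => (R / (L * Real.sqrt (tauMix P T))) / Real.sqrt (t : ℝ)) ξ x)
    {z : E} (hz : z ∈ X) {δ : ℝ} (hδ : 0 < δ) (hδ1 : δ < 1) (hTθ : tauMix P T ≤ (T : ℝ) / 2)
    (hbd : ∀ i, ∀ y ∈ X, ∀ᵐ s ∂(Q i), ‖G y s‖ ≤ L) :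
    1 - δ ≤ μ.real {ω | objective Q F (averageIterate x T ω) - objective Q F z ≤
        5 * R * L / 2 * (Real.sqrt (tauMix P T) / Real.sqrt (T : ℝ))
          + 2 * R * L / Real.sqrt (T : ℝ)
          + R * L / (T : ℝ) * tauMix P T
          + 3 * R * L / Real.sqrt (T : ℝ)
            * Real.sqrt (tauMix P T * Real.log (tauMix P T / δ))} := by
  have hTθ' := four_le_and_one_le_tauMix hn hσ hT hTθ
  set θ := tauMix P T with hθdef
  obtain ⟨hT4, hθ1⟩ := hTθ'
  have hθ : 0 < θ := by linarith
  set α : ℕ → ℝ := fun t => R / (L * Real.sqrt θ) / Real.sqrt (t : ℝ) with hα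
  have hαpos : ∀ t, 1 ≤ t → 0 < α t := stepSize_pos hR hL hθ
  have hdiam : ∀ y ∈ X, ∀ z ∈ X, ‖y - z‖ ≤ R := fun y hy z hz => hψ.norm_sub_le hR.le hy hz
  have hsq : ∀ i, ∀ y ∈ X, Integrable (fun s => ‖G y s‖ ^ 2) (Q i) ∧
      ∫ s, ‖G y s‖ ^ 2 ∂(Q i) ≤ L ^ 2 := fun i y hy =>
    hF.sq_norm_of_ae_norm_le i (hbd i y hy)
  have hxX : ∀ t, 1 ≤ t → ∀ ω, x t ω ∈ X := fun t ht => hx.mem_of_one_le ht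
  have hxm : ∀ t, Measurable[history token ξ t] (x (t + 1)) :=
    hx.measurable_history hψ hF.measurable_subgradient hαpos
  have hobj : ∀ y ∈ X, |objective Q F y - objective Q F z| ≤ R * L := fun y hy =>
    hF.abs_objective_sub_le hL hR.le hdiam hsq (by omega) hy hz
  have havg := fun ω => hF.objective_average_sub_le hψ.convex (fun t ht => hxX t ht ω) hT z
  have hσ0 : 0 ≤ secondSingularValue P := (Matrix.toEuclideanLin P).singularValues_nonneg 1
  have hRL : 0 < R * L := by positivity
  set τ := ⌊θ⌋₊ with hτdef
  have hτ : (τ : ℝ) ≤ θ := Nat.floor_le hθ.le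
  have hτT : τ < T := by
    have : (τ : ℝ) < T := by linarith
    exact_mod_cast this
  obtain ⟨N, hN⟩ : ∃ N, T = N + 1 + τ := ⟨T - τ - 1, by omega⟩
  set β := Real.sqrt n * secondSingularValue P ^ τ * (R * L) with hβ
  have hβ0 : 0 ≤ β := by positivity
  let Y : ℕ → Ω → ℝ := fun t ω => F z (ξ (t + τ + 1) ω) - F (x (t + 1) ω) (ξ (t + τ + 1) ω)
      + (objective Q F (x (t + 1) ω) - objective Q F z)
  -- Centred by the bias `β`, the errors are padded with zeros up to `(τ + 1) * q`, a full multiple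
  -- of the lag lying between `N + 1` and `T`.
  let Z : ℕ → Ω → ℝ := fun t ω => if t < N + 1 then Y t ω - β else 0
  let q := T / (τ + 1)
  have hq : 0 < q := Nat.div_pos (by omega) (by omega)
  have hqT : (τ + 1) * q ≤ T := Nat.mul_div_le T (τ + 1)
  have hqN : N + 1 ≤ (τ + 1) * q := by
    have := Nat.lt_mul_div_succ T (Nat.succ_pos τ)
    have h2 : (τ + 1) * (q + 1) = (τ + 1) * q + (τ + 1) := by ring
    have h3 : T < (τ + 1) * (q + 1) := this
    omega
  have hZm : ∀ t, Measurable[history token ξ (t + (τ + 1))] (Z t) := by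
    intro t
    simp only [Z]
    split_ifs
    · have h1 : Measurable[history token ξ (t + (τ + 1))] (x (t + 1)) :=
        (hxm t).mono (history_mono (by omega)) le_rfl
      have h2 : Measurable[history token ξ (t + (τ + 1))] (ξ (t + τ + 1)) :=
        measurable_sample_history ⟨by omega, by omega⟩
      have h3 : Measurable[history token ξ (t + (τ + 1))] (Y t) :=
        (hF.measurable_gap z).comp (h1.prodMk h2)
      exact h3.sub_const β
    · exact measurable_const
  have hmgf : ∀ t, ∀ l : ℝ, 0 ≤ l → ∀ S : Ω → ℝ, Measurable[history token ξ t] S →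
      ∫⁻ ω, ENNReal.ofReal (Real.exp (S ω + l * Z t ω)) ∂μ ≤
        ENNReal.ofReal (Real.exp (l ^ 2 * (R * L) ^ 2 / 2)) *
          ∫⁻ ω, ENNReal.ofReal (Real.exp (S ω)) ∂μ := by
    intro t l hl S hS
    by_cases ht : t < N + 1
    · simp only [Z, if_pos ht]
      exact hξ.lintegral_exp_gap_le hn hP hσ hF hL hR.le hdiam hsq hbd t τ (hxm t)
        (hxX (t + 1) (by omega)) hz hl hS
    · simp only [Z, if_neg ht, mul_zero, add_zero]
      refine le_mul_of_one_le_left' ?_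
      rw [← ENNReal.ofReal_one]
      exact ENNReal.ofReal_le_ofReal (Real.one_le_exp (by positivity))
  have hlog : 0 < Real.log (1 / δ) := Real.log_pos ((one_lt_div hδ).2 hδ1)
  -- Chosen so that the Azuma bound, with `(τ + 1) * q` enlarged to `T`, equals `δ`.
  set γ := R * L * Real.sqrt (2 * (τ + 1 : ℕ) * T * Real.log (1 / δ)) with hγ
  have htail := measureReal_interleaved_sum_ge_le (μ := μ)
    (fun s t hst => history_mono hst) hξ.history_le (Nat.succ_pos τ)
    (by positivity : 0 < (R * L) ^ 2) hZm hmgf hq (γ := γ) (by positivity)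
  have hexp : Real.exp (-(γ ^ 2 / (2 * (τ + 1 : ℕ) * ((τ + 1 : ℕ) * q) * (R * L) ^ 2))) ≤ δ := by
    have hT0 : (0 : ℝ) < T := by exact_mod_cast hT
    have hq0 : (0 : ℝ) < q := by exact_mod_cast hq
    have hqT' : ((τ + 1 : ℕ) : ℝ) * q ≤ T := by exact_mod_cast hqT
    rw [hγ, mul_pow, Real.sq_sqrt (by positivity)]
    have h1 : Real.log (1 / δ) ≤ (R * L) ^ 2 * (2 * (τ + 1 : ℕ) * T * Real.log (1 / δ)) /
        (2 * (τ + 1 : ℕ) * ((τ + 1 : ℕ) * q) * (R * L) ^ 2) := by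
      rw [le_div_iff₀ (by positivity)]
      have h2 := mul_le_mul_of_nonneg_left hqT'
        (by positivity : 0 ≤ Real.log (1 / δ) * (2 * (τ + 1 : ℕ)) * (R * L) ^ 2)
      linarith
    calc _ ≤ Real.exp (-Real.log (1 / δ)) := Real.exp_le_exp.2 (neg_le_neg h1)
      _ = δ := by
        rw [one_div, Real.log_inv, neg_neg, Real.exp_log hδ]
  have hnorm1 : ∀ᵐ ω ∂μ, ∀ t, ‖G (x (t + 1) ω) (ξ (t + τ + 1) ω)‖ ≤ L :=
    ae_all_iff.2 fun t => hξ.ae_norm_le hn hP hσ hF hbd t τ (hxm t) (hxX (t + 1) (by omega))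
  have hnorm2 : ∀ᵐ ω ∂μ, ∀ t, ‖G (x (t + 1) ω) (ξ (t + 1) ω)‖ ≤ L :=
    ae_all_iff.2 fun t => hξ.ae_norm_le hn hP hσ hF hbd t 0 (hxm t) (hxX (t + 1) (by omega))
  -- The coefficient `2` of `RL√T` is one from `T β ≤ 2RL ≤ RL√T`, as `T ≥ 4`, and one from `1 / √θ
  -- ≤ 1`.
  have hbudget : γ + T * β + (5 / 2 * (R * L) * Real.sqrt θ * Real.sqrt T
      + R * L * Real.sqrt T / Real.sqrt θ + R * L * θ) ≤
      5 / 2 * (R * L) * Real.sqrt θ * Real.sqrt T + 2 * (R * L) * Real.sqrt T + R * L * θ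
        + 3 * (R * L) * Real.sqrt T * Real.sqrt (θ * Real.log (θ / δ)) := by
    have hT0 : (0 : ℝ) < T := by exact_mod_cast hT
    have hT4' : (4 : ℝ) ≤ T := by exact_mod_cast hT4
    have hsT : 2 ≤ Real.sqrt (T : ℝ) := Real.le_sqrt_of_sq_le (by linarith)
    have hsθ : 1 ≤ Real.sqrt θ := Real.one_le_sqrt.2 hθ1
    have h1 : (T : ℝ) * β ≤ R * L * Real.sqrt T := by
      have h2 := mixing_error_le hn hσ hT
      rw [← hθdef, ← hτdef] at h2
      calc (T : ℝ) * β = T * (Real.sqrt n * secondSingularValue P ^ τ) * (R * L) := by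
            rw [hβ]; ring
        _ ≤ 2 * (R * L) := by gcongr
        _ ≤ Real.sqrt T * (R * L) := by gcongr
        _ = _ := mul_comm _ _
    have h2 : R * L * Real.sqrt T / Real.sqrt θ ≤ R * L * Real.sqrt T :=
      div_le_self (by positivity) hsθ
    have h3 : γ ≤ 3 * (R * L) * Real.sqrt T * Real.sqrt (θ * Real.log (θ / δ)) := by
      have h4 : Real.log (1 / δ) ≤ Real.log (θ / δ) :=
        Real.log_le_log (by positivity) (by gcongr)
      -- `2(τ + 1) ≤ 4θ` since `θ ≥ 1`; the factor `3 = √9` leaves room.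
      have h5 : 2 * ((τ + 1 : ℕ) : ℝ) ≤ 9 * θ := by push_cast; linarith
      have h6 : Real.sqrt (2 * (τ + 1 : ℕ) * T * Real.log (1 / δ)) ≤
          3 * Real.sqrt T * Real.sqrt (θ * Real.log (θ / δ)) := by
        have h7 : 3 * Real.sqrt T * Real.sqrt (θ * Real.log (θ / δ)) =
            Real.sqrt (9 * θ * T * Real.log (θ / δ)) := by
          rw [show 9 * θ * T * Real.log (θ / δ) = 3 ^ 2 * (T * (θ * Real.log (θ / δ))) by ring,
            Real.sqrt_mul (by norm_num : (0 : ℝ) ≤ 3 ^ 2),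
            Real.sqrt_sq (by norm_num : (0 : ℝ) ≤ 3), Real.sqrt_mul hT0.le]
          ring
        rw [h7]
        apply Real.sqrt_le_sqrt
        gcongr
      calc γ ≤ R * L * (3 * Real.sqrt T * Real.sqrt (θ * Real.log (θ / δ))) := by
            rw [hγ]; gcongr
        _ = _ := by ring
    linarith
  have hgood : ∀ᵐ ω ∂μ, ¬ (γ ≤ ∑ t ∈ Finset.range ((τ + 1) * q), Z t ω) →
      objective Q F (averageIterate x T ω) - objective Q F z ≤
        5 * R * L / 2 * (Real.sqrt θ / Real.sqrt (T : ℝ))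
          + 2 * R * L / Real.sqrt (T : ℝ) + R * L / (T : ℝ) * θ
          + 3 * R * L / Real.sqrt (T : ℝ) * Real.sqrt (θ * Real.log (θ / δ)) := by
    filter_upwards [hnorm1, hnorm2] with ω hω1 hω2 hlt
    have hT0 : (0 : ℝ) < T := by exact_mod_cast hT
    have hsT : 0 < Real.sqrt (T : ℝ) := Real.sqrt_pos.2 hT0
    have hsT2 : Real.sqrt (T : ℝ) ^ 2 = T := Real.sq_sqrt hT0.le
    have hω2' : ∀ t, 1 ≤ t → ‖G (x t ω) (ξ t ω)‖ ≤ L := by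
      intro t ht
      obtain ⟨t, rfl⟩ := Nat.exists_eq_add_of_le' ht
      exact hω2 t
    have hZY : ∑ t ∈ Finset.range ((τ + 1) * q), Z t ω =
        ∑ t ∈ Finset.range (N + 1), Y t ω - (N + 1 : ℕ) * β := by
      rw [← Finset.sum_subset (Finset.range_subset_range.2 hqN) (fun t _ ht => if_neg fun h =>
        ht (Finset.mem_range.2 h)), Finset.sum_congr rfl fun t ht =>
        (if_pos (Finset.mem_range.1 ht) : Z t ω = Y t ω - β), Finset.sum_sub_distrib]
      simp
    have hNβ : ((N + 1 : ℕ) : ℝ) * β ≤ T * β :=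
      mul_le_mul_of_nonneg_right (by exact_mod_cast (by omega : N + 1 ≤ T)) hβ0
    have h5 := gap_budget_le (N := N) hR hL hθ hτ hα
    have h6 := hψ.sum_gap_le (y := fun t => x t ω) (α := α) (Fs := fun t y => F y (ξ t ω))
        (Gs := fun t y => G y (ξ t ω)) (fun t ht => hxX t ht ω) hαpos
        (stepSize_succ_le hR hL hθ)
        (fun t => hF.subgradient (ξ t ω)) (fun t ht => hx.argmin t ht ω) hz
        (fun w hw => (le_abs_self _).trans (hobj w hw)) τ N
    rw [← hN] at h5 h6
    have h7 : ∑ t ∈ Finset.range (N + 1), ∑ j ∈ Finset.range τ, α (t + 1 + j) *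
        ((‖G (x (t + 1) ω) (ξ (t + τ + 1) ω)‖ ^ 2
          + ‖G (x (t + 1 + j) ω) (ξ (t + 1 + j) ω)‖ ^ 2) / 2) ≤
        ∑ t ∈ Finset.range (N + 1), ∑ j ∈ Finset.range τ, α (t + 1 + j) * L ^ 2 := by
      refine Finset.sum_le_sum fun t _ => Finset.sum_le_sum fun j _ =>
        mul_le_mul_of_nonneg_left ?_ (hαpos _ (by omega)).le
      have h8 := pow_le_pow_left₀ (norm_nonneg _) (hω1 t) 2
      have h9 := pow_le_pow_left₀ (norm_nonneg _) (hω2' (t + 1 + j) (by omega)) 2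
      linarith
    have h8 : ∑ i ∈ Finset.range (N + 1),
        α (τ + 1 + i) / 2 * ‖G (x (τ + 1 + i) ω) (ξ (τ + 1 + i) ω)‖ ^ 2 ≤
        ∑ i ∈ Finset.range (N + 1), α (τ + 1 + i) / 2 * L ^ 2 :=
      Finset.sum_le_sum fun i _ => mul_le_mul_of_nonneg_left
        (pow_le_pow_left₀ (norm_nonneg _) (hω2' _ (by omega)) 2)
        (half_pos (hαpos _ (by omega))).le
    have h9 : ∑ t ∈ Finset.range T, (objective Q F (x (t + 1) ω) - objective Q F z) ≤
        5 / 2 * (R * L) * Real.sqrt θ * Real.sqrt T + 2 * (R * L) * Real.sqrt T + R * L * θ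
        + 3 * (R * L) * Real.sqrt T * Real.sqrt (θ * Real.log (θ / δ)) := by
      rw [hZY] at hlt
      have hlt' := lt_of_not_ge hlt
      simp only [Y] at hlt'
      linarith
    refine (havg ω).2.trans ((mul_le_mul_of_nonneg_left h9 (by positivity)).trans (le_of_eq ?_))
    rw [← hsT2]
    field_simp
    rw [Real.sqrt_sq hsT.le]
    ring
  -- Almost every `ω` lies in the good event or in the tail event; the union bound needs no
  -- measurability of either.
  have hcover : (1 : ℝ) ≤ μ.real {ω | objective Q F (averageIterate x T ω) - objective Q F z ≤
        5 * R * L / 2 * (Real.sqrt θ / Real.sqrt (T : ℝ))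
          + 2 * R * L / Real.sqrt (T : ℝ) + R * L / (T : ℝ) * θ
          + 3 * R * L / Real.sqrt (T : ℝ) * Real.sqrt (θ * Real.log (θ / δ))} +
      μ.real {ω | γ ≤ ∑ t ∈ Finset.range ((τ + 1) * q), Z t ω} := by
    rw [← probReal_univ (μ := μ)]
    refine le_trans ?_ (measureReal_union_le _ _)
    refine ENNReal.toReal_mono (measure_ne_top _ _) (measure_mono_ae ?_)
    filter_upwards [hgood] with ω hω _
    by_cases h : γ ≤ ∑ t ∈ Finset.range ((τ + 1) * q), Z t ω
    · exact Or.inr h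
    · exact Or.inl (hω h)
  have := htail.trans hexp
  linarith

end Assembly

theorem corollary3
    {E : Type*} [NormedAddCommGroup E] [NormedSpace ℝ E] [FiniteDimensional ℝ E]
    [MeasurableSpace E] [BorelSpace E]
    {Ξ : Type*} [MeasurableSpace Ξ]
    {Ω : Type*} [MeasurableSpace Ω] (μ : Measure Ω) [IsProbabilityMeasure μ]
    (X : Set E) (ψ : E → ℝ) (R L : ℝ) (hR : 0 < R) (hL : 0 < L) (hψ : IsProxSetup X ψ R)
    (n : ℕ) (hn : 2 ≤ n)
    (P : Matrix (Fin n) (Fin n) ℝ) (hP : P ∈ doublyStochastic ℝ (Fin n))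
    (hσ : secondSingularValue P < 1)
    (Q : Fin n → Measure Ξ) [∀ i, IsProbabilityMeasure (Q i)]
    (F : E → Ξ → ℝ) (G : E → Ξ → StrongDual ℝ E) (hF : IsLossFamily X Q F G)
    (token : ℕ → Ω → Fin n) (ξ : ℕ → Ω → Ξ) (hξ : IsTokenSampling μ P Q token ξ)
    (T : ℕ) (hT : 1 ≤ T)
    (x : ℕ → Ω → E)
    (hx : IsMirrorDescent X ψ G
      (fun t => (R / (L * Real.sqrt (tauMix P T))) / Real.sqrt (t : ℝ)) ξ x)
    (xstar : E) (hxstar : xstar ∈ X) :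
    ((∀ i, ∀ y ∈ X, Integrable (fun s => ‖G y s‖ ^ 2) (Q i) ∧
        ∫ s, ‖G y s‖ ^ 2 ∂(Q i) ≤ L ^ 2) →
      Integrable (fun ω => objective Q F (averageIterate x T ω)) μ ∧
      (∫ ω, objective Q F (averageIterate x T ω) ∂μ) - objective Q F xstar ≤
        5 * R * L / 2 * (Real.sqrt (tauMix P T) / Real.sqrt (T : ℝ))
          + 5 * R * L / Real.sqrt (T : ℝ)
          + R * L / (T : ℝ) * tauMix P T)
    ∧
    (∀ δ : ℝ, 0 < δ → δ < 1 → tauMix P T ≤ (T : ℝ) / 2 →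
      (∀ i, ∀ y ∈ X, ∀ᵐ s ∂(Q i), ‖G y s‖ ≤ L) →
      1 - δ ≤ μ.real {ω | objective Q F (averageIterate x T ω) - objective Q F xstar ≤
        5 * R * L / 2 * (Real.sqrt (tauMix P T) / Real.sqrt (T : ℝ))
          + 2 * R * L / Real.sqrt (T : ℝ)
          + R * L / (T : ℝ) * tauMix P T
          + 3 * R * L / Real.sqrt (T : ℝ)
            * Real.sqrt (tauMix P T * Real.log (tauMix P T / δ))}) := by
  refine ⟨fun hsq => integral_objective_average_le hR hL hψ hn hP hσ hF hξ hT hx hxstar hsq,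
    fun δ hδ hδ1 hTθ hbd => ?_⟩
  exact measureReal_objective_average_le hR hL hψ hn hP hσ hF hξ hT hx hxstar hδ hδ1 hTθ hbd
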